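/- **Notation.** Logarithms are to base 2. Let $\mathcal M=(E,\mathcal I)$ be a matroid on $n=|E|\ge 2$ elements. For a uniformly random ordering $\pi$ of the ground set, let $C_\pi$ be the first circuit that appears when the elements are added in the order $\pi$ (if the ground set is independent there is no such circuit, and the events below do not occur). For a set $T$ put $p_{T,\mathcal M}=\Pr_\pi[T\cap C_\pi\ne\emptyset]$ and $q_{T,\mathcal M}=\Pr_\pi[C_\pi\subseteq T]$. For $S\subseteq E$ let $\alpha(S)$ be the least $k$ such that a uniformly random $k$-element subset of $S$ is independent with probability at most $1/2$. A set $S\subseteq E$ is *globally optimal* in $\mathcal M$ if $q_{S,\mathcal M}\ge 1-2^{-20}$ and $p_{T,\mathcal M|_S}\ge \frac{|T|}{2^{21}|S|\log n}$ for all $T\subseteq S$. A set $D\subseteq S$ consists of *redundant* elements of $S$ if $D\subseteq\mathrm{span}(S\setminus D)$. A *one-round procedure* on $E$ is a randomized procedure with access to the independence oracle of $\mathcal M$ and with input $S$; its batch of queried sets depends only on $E$, $S$ and its random string, and its output depends only on these and on the answers to the batch. Only oracle queries are counted. **Theorem.** There are absolute constants $c_1,c_2>0$ and $k,d\in\mathbb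 N$ such that for every finite set $E$ with $n=|E|\ge2$ there is a one-round procedure on $E$, making at most $n^d$ independence queries, with the following property. For every matroid $\mathcal M$ with ground set $E$ and every globally optimal set $S$ in $\mathcal M$ with $\alpha(S)/|S|<1/\log n$, with probability at least $1-2^{-c_2n}$ the procedure outputs a set $D\subseteq S$ of redundant elements of $S$ with $$|D|\;\ge\;\frac{c_1}{(\log n)^k}\,\min\!\left(|S|,\frac{|S|^{3/2}}{\alpha(S)}\right).$$ In other words, a single round of polynomially many queries suffices to delete $\widetilde\Omega\bigl(\min(|S|,|S|^{3/2}/\alpha(S))\bigr)$ redundant elements of $S$ with probability $1-2^{-\Omega(n)}$. -/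

import Mathlib

universe u

noncomputable section

/-- The probability of the event `P` when `ω` is drawn uniformly at random from the finite
nonempty type `Ω`. -/
def uniformPr (Ω : Type*) (P : Ω → Prop) : ℝ :=
  (Nat.card {ω : Ω // P ω} : ℝ) / (Nat.card Ω : ℝ)

/-- Orderings (permutations) `π` of the finite ground set of `M`. -/
abbrev GroundOrder {V : Type u} (M : Matroid V) : Type u :=
  Fin M.E.ncard ≃ M.E

/-- The set of the first `j` elements of the ordering `π`. -/
def orderPrefix {V : Type u} {M : Matroid V} (π : GroundOrder M) (j : ℕ) : Set V :=
  {x | ∃ i : Fin M.E.ncard, (i : ℕ) < j ∧ (π i : V) = x}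

/-- `C` is the circuit `C_π`, the first one to appear when the elements are added in the order `π`:
some prefix is independent, and the next prefix contains the circuit `C`. There is at most one such
`C`, and there is none exactly when the whole ground set is independent. -/
def IsFirstCircuit {V : Type u} (M : Matroid V) (π : GroundOrder M) (C : Set V) : Prop :=
  ∃ j : ℕ, M.Indep (orderPrefix π j) ∧ M.IsCircuit C ∧ C ⊆ orderPrefix π (j + 1)

/-- The hitting probability `p_{T,M} = Pr_π[T ∩ C_π ≠ ∅]`. -/
def hittingProb {V : Type u} (M : Matroid V) (T : Set V) : ℝ :=
  uniformPr (GroundOrder M) fun π => ∃ C, IsFirstCircuit M π C ∧ (T ∩ C).Nonempty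

/-- The circuit mass `q_{T,M} = Pr_π[C_π ⊆ T]`. -/
def circuitMass {V : Type u} (M : Matroid V) (T : Set V) : ℝ :=
  uniformPr (GroundOrder M) fun π => ∃ C, IsFirstCircuit M π C ∧ C ⊆ T

/-- The probability that a uniformly random `k`-element subset of `S` is independent. -/
def indepProb {V : Type u} (M : Matroid V) (S : Finset V) (k : ℕ) : ℝ :=
  uniformPr {T : Finset V // T ∈ S.powersetCard k} fun T => M.Indep (T.1 : Set V)

/-- The parameter `α(S)`: the least `k` (among the `k` for which `S` has `k`-element subsets) such
that a uniformly random `k`-element subset of `S` is independent with probability at most `1/2`. -/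
def circuitMedian {V : Type u} (M : Matroid V) (S : Finset V) : ℕ :=
  sInf {k : ℕ | k ≤ S.card ∧ indepProb M S k ≤ 1 / 2}

/-- `S` is globally optimal in the matroid `M` on `n = |E|` elements. Logarithms are to base 2. -/
structure IsGloballyOptimal {V : Type u} (M : Matroid V) (S : Finset V) : Prop where
  subset_ground : (S : Set V) ⊆ M.E
  mass : 1 - 1 / 2 ^ 20 ≤ circuitMass M (S : Set V)
  hitting : ∀ T : Finset V, T ⊆ S →
    (T.card : ℝ) / (2 ^ 21 * (S.card : ℝ) * Real.logb 2 (M.E.ncard : ℝ)) ≤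
      hittingProb (M.restrict (S : Set V)) (T : Set V)

/-- `D` is a set of redundant elements of `S`, all of which can be deleted simultaneously: each
element of `D` lies in the span of the elements of `S` that are kept. -/
def IsRedundantIn {V : Type u} (M : Matroid V) (S D : Finset V) : Prop :=
  D ⊆ S ∧ (D : Set V) ⊆ M.closure ((S : Set V) \ (D : Set V))

/-- A randomized procedure that makes a single round of queries to an oracle on subsets of `V`, on
input a set `S`. A random string `ω` is drawn uniformly; the batch of queried sets is a function of
`S` and `ω` alone; the output is a function of `S`, `ω` and the answers to the queries of the
batch. As usual for round complexity, only oracle queries are counted. -/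
structure OneRoundProcedure (V : Type u) where
  Coins : Type u
  finite_coins : Finite Coins
  nonempty_coins : Nonempty Coins
  queries : Finset V → Coins → Finset (Finset V)
  output : (S : Finset V) → (ω : Coins) → ({Q : Finset V // Q ∈ queries S ω} → Bool) → Finset V

/-- The set returned on input `S` and random string `ω`, with access to the oracle `Ind`. -/
def OneRoundProcedure.run {V : Type u} (A : OneRoundProcedure V) (Ind : Finset V → Bool)
    (S : Finset V) (ω : A.Coins) : Finset V :=
  A.output S ω fun Q => Ind Q.1

open Classical in
/-- The independence oracle of a matroid. -/
def indepOracle {V : Type u} (M : Matroid V) : Finset V → Bool :=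
  fun Q => decide (M.Indep (Q : Set V))

end

/-! The proof deletes about `|S| / log n` elements, which dominates the required minimum. Let `l` be
the integer part of `log n`. The hypothesis on `α(S)` fits `l / 2` blocks of length `α(S)` into the
first half of a random ordering of `S`, so that half is independent with probability at most `2 ^
(-(l / 2))`, far below the hitting bound for a set of `|S| / 2` elements. Hence at least half of the
elements `x` are spanned, with probability at least `n ^ (-7)`, by an independent random set of
elements of label below some `k < |S| / 2`, the labels being independent and uniform
(`IsGloballyOptimal.card_spanned`).

Such rare events must serve many `x` at once, with spanning sets that avoid every deleted element.
Colour `S` with `2r = O(log n)` colours and fix the labels of one random colour class. By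
`half_coordinates_good` an event of probability `1 / Q` with `2Q ≤ 2 ^ r` keeps, for half of the
classes and with probability `1/2`, conditional probability at least `1 / (4rQ)`. Polynomially many
resamplings of the other labels then detect a given `x` with constant probability. Delete the
detected elements of the fixed class whose label is at least `|S| / 2`: their labels never change,
so no queried set of labels below `k < |S| / 2` meets them, and all are redundant simultaneously.

A trial finds each suitable `x` with probability `1 / (32r)` (`uniformPr_trial_ge`). A reverse
Markov inequality and `64rn` independent trials give the claimed size and failure probability. The
output is a largest set certified by the answers, so it suffices that some trial certifies a large
set. -/

/-! ### Uniform probabilities on finite types. -/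

section UniformPr

open Classical in
theorem uniformPr_eq_sum {Ω : Type*} [Fintype Ω] (P : Ω → Prop) :
    uniformPr Ω P = (∑ ω, if P ω then (1 : ℝ) else 0) / Fintype.card Ω := by
  rw [uniformPr, Nat.card_eq_fintype_card, Nat.card_eq_fintype_card, Fintype.card_subtype,
    Finset.sum_boole]

theorem uniformPr_nonneg {Ω : Type*} (P : Ω → Prop) : 0 ≤ uniformPr Ω P := by
  unfold uniformPr; positivity

theorem uniformPr_mono {Ω : Type*} [Finite Ω] {P Q : Ω → Prop} (h : ∀ ω, P ω → Q ω) :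
    uniformPr Ω P ≤ uniformPr Ω Q := by
  unfold uniformPr
  gcongr
  exact Nat.card_le_card_of_injective (Subtype.map id h) (Subtype.map_injective h fun _ _ h => h)

theorem uniformPr_congr {Ω : Type*} {P Q : Ω → Prop} (h : ∀ ω, P ω ↔ Q ω) :
    uniformPr Ω P = uniformPr Ω Q := by
  rw [show P = Q from funext fun ω => propext (h ω)]

theorem uniformPr_le_one {Ω : Type*} [Finite Ω] (P : Ω → Prop) : uniformPr Ω P ≤ 1 := by
  unfold uniformPr
  apply div_le_one_of_le₀ _ (by positivity)
  exact_mod_cast Nat.card_le_card_of_injective _ Subtype.val_injective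

theorem uniformPr_of_forall {Ω : Type*} [Finite Ω] [Nonempty Ω] {P : Ω → Prop} (h : ∀ ω, P ω) :
    uniformPr Ω P = 1 := by
  have : Nat.card {ω // P ω} = Nat.card Ω := Nat.card_congr (Equiv.subtypeUnivEquiv h)
  rw [uniformPr, this, div_self]
  exact_mod_cast Nat.card_pos.ne'

theorem uniformPr_equiv {α β : Type*} (e : α ≃ β) (P : β → Prop) :
    uniformPr α (fun a => P (e a)) = uniformPr β P := by
  unfold uniformPr
  rw [Nat.card_congr e, Nat.card_congr (e.subtypeEquiv (p := fun a => P (e a)) (q := P)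
    fun _ => Iff.rfl)]

theorem uniformPr_compl {Ω : Type*} [Finite Ω] [Nonempty Ω] (P : Ω → Prop) :
    uniformPr Ω (fun ω => ¬ P ω) = 1 - uniformPr Ω P := by
  classical
  cases nonempty_fintype Ω
  have h : (Fintype.card Ω : ℝ) ≠ 0 := by exact_mod_cast Fintype.card_ne_zero
  rw [uniformPr_eq_sum, uniformPr_eq_sum, eq_sub_iff_add_eq, ← add_div, ← Finset.sum_add_distrib,
    div_eq_one_iff_eq h, Fintype.card, Finset.card_eq_sum_ones, Nat.cast_sum]
  refine Finset.sum_congr rfl fun ω _ => ?_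
  by_cases h : P ω <;> simp [h]

theorem uniformPr_exists_le {Ω κ : Type*} [Finite Ω] (s : Finset κ) (P : κ → Ω → Prop) :
    uniformPr Ω (fun ω => ∃ i ∈ s, P i ω) ≤ ∑ i ∈ s, uniformPr Ω (P i) := by
  classical
  cases nonempty_fintype Ω
  simp_rw [uniformPr_eq_sum]
  rw [← Finset.sum_div, Finset.sum_comm]
  gcongr with ω
  split_ifs with h
  · obtain ⟨i, hi, hP⟩ := h
    calc (1 : ℝ) = if P i ω then 1 else 0 := by simp [hP]
      _ ≤ _ := Finset.single_le_sum (f := fun i => if P i ω then (1 : ℝ) else 0)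
        (fun _ _ => by positivity) hi
  · positivity

theorem uniformPr_or_le {Ω : Type*} [Finite Ω] (P Q : Ω → Prop) :
    uniformPr Ω (fun ω => P ω ∨ Q ω) ≤ uniformPr Ω P + uniformPr Ω Q := by
  have h := uniformPr_exists_le (Ω := Ω) Finset.univ fun b : Bool => if b then P else Q
  simp only [Finset.mem_univ, true_and, Bool.exists_bool, Fintype.sum_bool, if_true,
    Bool.false_eq_true, if_false] at h
  exact (uniformPr_mono fun _ h => h.symm).trans h

/-- Fubini for uniform probabilities. -/
theorem uniformPr_prod {α β : Type*} [Fintype α] [Finite β] (P : α → β → Prop) :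
    uniformPr (α × β) (fun z => P z.1 z.2) = (∑ a, uniformPr β (P a)) / Fintype.card α := by
  classical
  cases nonempty_fintype β
  simp_rw [uniformPr_eq_sum]
  rw [← Finset.sum_div, Fintype.sum_prod_type, Fintype.card_prod, div_div, Nat.cast_mul, mul_comm]

theorem uniformPr_prod_comm {α β : Type*} (P : α → β → Prop) :
    uniformPr (α × β) (fun z => P z.1 z.2) = uniformPr (β × α) (fun z => P z.2 z.1) :=
  uniformPr_equiv (Equiv.prodComm α β) fun z => P z.2 z.1

theorem mul_le_uniformPr_prod {α β : Type*} [Finite α] [Finite β] {A : α → Prop}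
    {P : α → β → Prop} {p q : ℝ} (hq : 0 ≤ q) (hA : p ≤ uniformPr α A)
    (h : ∀ a, A a → q ≤ uniformPr β (P a)) :
    p * q ≤ uniformPr (α × β) (fun z => P z.1 z.2) := by
  classical
  cases nonempty_fintype α
  refine (mul_le_mul_of_nonneg_right hA hq).trans ?_
  rw [uniformPr_prod, uniformPr_eq_sum, div_mul_eq_mul_div, Finset.sum_mul]
  gcongr with a
  split_ifs with ha
  · simpa using h a ha
  · simpa using uniformPr_nonneg _

theorem uniformPr_prod_le {α β : Type*} [Finite α] [Nonempty α] [Finite β]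
    {P : α → β → Prop} {q : ℝ} (h : ∀ a, uniformPr β (P a) ≤ q) :
    uniformPr (α × β) (fun z => P z.1 z.2) ≤ q := by
  cases nonempty_fintype α
  rw [uniformPr_prod, div_le_iff₀ (by exact_mod_cast Fintype.card_pos)]
  calc _ ≤ ∑ _a : α, q := Finset.sum_le_sum fun a _ => h a
    _ = _ := by simp [mul_comm]

theorem uniformPr_prod_fst {α β : Type*} [Finite α] [Finite β] [Nonempty β] (P : α → Prop) :
    uniformPr (α × β) (fun z => P z.1) = uniformPr α P := by
  classical
  cases nonempty_fintype α
  rw [uniformPr_prod (fun a _ => P a), uniformPr_eq_sum]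
  congr 1
  refine Finset.sum_congr rfl fun a _ => ?_
  split_ifs with h
  · exact uniformPr_of_forall fun _ => h
  · simp [uniformPr, h]

theorem uniformPr_pi {κ Ω : Type*} [Fintype κ] [Finite Ω] (P : κ → Ω → Prop) :
    uniformPr (κ → Ω) (fun ω => ∀ i, P i (ω i)) = ∏ i, uniformPr Ω (P i) := by
  classical
  cases nonempty_fintype Ω
  have h : Nat.card {ω : κ → Ω // ∀ i, P i (ω i)} = ∏ i, Nat.card {a // P i a} := by
    rw [← Nat.card_pi]
    exact Nat.card_congr (Equiv.subtypePiEquivPi (p := fun i => P i))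
  rw [uniformPr, h, Nat.card_fun]
  simp [uniformPr, Finset.prod_div_distrib]

/-- Swapping the coordinate `x` of a function with an independent value. -/
def updateSwap {ι Λ : Type*} [DecidableEq ι] (x : ι) : (ι → Λ) × Λ ≃ (ι → Λ) × Λ where
  toFun z := (Function.update z.1 x z.2, z.1 x)
  invFun z := (Function.update z.1 x z.2, z.1 x)
  left_inv z := by simp
  right_inv z := by simp

/-- `updateSwap` is a bijection, so a coordinate may be drawn separately from the rest; this
replaces conditioning on its value. -/
theorem uniformPr_update {ι Λ : Type*} [Finite ι] [DecidableEq ι] [Finite Λ] [Nonempty Λ]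
    (x : ι) (P : (ι → Λ) → Prop) :
    uniformPr (Λ × (ι → Λ)) (fun z => P (Function.update z.2 x z.1)) = uniformPr (ι → Λ) P := by
  rw [← uniformPr_prod_comm (fun (b : ι → Λ) a => P (Function.update b x a)),
    ← uniformPr_prod_fst (β := Λ) P]
  exact uniformPr_equiv (updateSwap (Λ := Λ) x) fun z => P z.1

theorem uniformPr_and_coord {ι Λ : Type*} [Finite ι] [Finite Λ] [Nonempty Λ]
    (x : ι) {P : (ι → Λ) → Prop} (hP : ∀ f g : ι → Λ, (∀ y, y ≠ x → f y = g y) → P f → P g)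
    (B : Λ → Prop) :
    uniformPr (ι → Λ) (fun f => P f ∧ B (f x)) = uniformPr (ι → Λ) P * uniformPr Λ B := by
  classical
  have h1 : uniformPr ((ι → Λ) × Λ) (fun z => P z.1 ∧ B z.2) =
      uniformPr (ι → Λ) (fun f => P f ∧ B (f x)) := by
    rw [← uniformPr_prod_fst (β := Λ) (fun f : ι → Λ => P f ∧ B (f x)),
      ← uniformPr_equiv (updateSwap (Λ := Λ) x)]
    refine uniformPr_congr fun z => ?_
    have h : P (Function.update z.1 x z.2) ↔ P z.1 :=
      ⟨hP _ _ fun y hy => by simp [hy], hP _ _ fun y hy => by simp [hy]⟩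
    simp [updateSwap, h]
  cases nonempty_fintype ι
  cases nonempty_fintype Λ
  rw [← h1, uniformPr_prod (fun f b => P f ∧ B b), uniformPr_eq_sum P, div_mul_eq_mul_div,
    Finset.sum_mul]
  congr 1
  refine Finset.sum_congr rfl fun f _ => ?_
  split_ifs with h <;> simp [h, uniformPr]

/-- Restricting a uniformly random function along an injection gives a uniformly random
function. -/
theorem uniformPr_comp_injective {ι κ Λ : Type*} [Finite ι] [Finite κ] [Finite Λ] [Nonempty Λ]
    {g : ι → κ} (hg : g.Injective) (P : (ι → Λ) → Prop) :
    uniformPr (κ → Λ) (fun f => P (fun y => f (g y))) = uniformPr (ι → Λ) P := by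
  classical
  let e₁ := Equiv.piEquivPiSubtypeProd (fun k => k ∈ Set.range g) fun _ => Λ
  let e₂ : ι ≃ {k // k ∈ Set.range g} := Equiv.ofInjective g hg
  rw [← uniformPr_prod_fst (β := {k // k ∉ Set.range g} → Λ) P,
    ← uniformPr_equiv (e₁.trans ((e₂.arrowCongr (Equiv.refl Λ)).symm.prodCongr (Equiv.refl _)))]
  rfl

theorem uniformPr_eval {κ : Type*} {Ω : κ → Type*} [Finite κ] [∀ i, Finite (Ω i)]
    [∀ i, Nonempty (Ω i)] (i : κ) (P : Ω i → Prop) :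
    uniformPr (∀ i, Ω i) (fun ω => P (ω i)) = uniformPr (Ω i) P := by
  classical
  rw [← uniformPr_prod_fst (β := ∀ j : {j // j ≠ i}, Ω j) P,
    ← uniformPr_equiv (Equiv.piSplitAt i Ω)]
  rfl

/-- A reverse Markov inequality for the size of a random set. -/
theorem uniformPr_card_ge {Ω ι : Type*} [Finite Ω] [Nonempty Ω] {X : Finset ι} (hX : X.Nonempty)
    {D : Ω → Finset ι} {p : ℝ} (hp : ∀ x ∈ X, p ≤ uniformPr Ω fun ω => x ∈ D ω) :
    p / 2 ≤ uniformPr Ω fun ω => p * X.card / 2 ≤ (D ω).card := by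
  classical
  cases nonempty_fintype Ω
  have hX' : (0 : ℝ) < X.card := by exact_mod_cast hX.card_pos
  have hc : (0 : ℝ) < Fintype.card Ω := by exact_mod_cast Fintype.card_pos
  set A : Ω → Prop := fun ω => p * X.card / 2 ≤ (D ω).card with hA
  have h1 : p * X.card ≤ (∑ ω, ((X.filter (· ∈ D ω)).card : ℝ)) / Fintype.card Ω := by
    calc p * X.card = ∑ x ∈ X, p := by simp [mul_comm]
      _ ≤ ∑ x ∈ X, uniformPr Ω fun ω => x ∈ D ω := Finset.sum_le_sum hp
      _ = _ := by
        simp_rw [uniformPr_eq_sum]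
        rw [← Finset.sum_div, Finset.sum_comm]
        refine congrArg (· / _) (Finset.sum_congr rfl fun ω _ => ?_)
        rw [Finset.card_filter, Nat.cast_sum]
        exact Finset.sum_congr rfl fun x _ => by split_ifs <;> simp
  by_cases hp0 : p < 0
  · linarith [uniformPr_nonneg A]
  -- Off `A` the count is below `p |X| / 2`; on `A` it is bounded trivially by `|X|`. Averaging
  -- leaves at least `p / 2` for the probability of `A`.
  have h2 : ∀ ω, ((X.filter (· ∈ D ω)).card : ℝ) ≤
      p * X.card / 2 + X.card * (if A ω then 1 else 0) := by
    intro ω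
    have h3 : ((X.filter (· ∈ D ω)).card : ℝ) ≤ X.card := by
      exact_mod_cast Finset.card_filter_le _ _
    have h4 : ((X.filter (· ∈ D ω)).card : ℝ) ≤ (D ω).card := by
      exact_mod_cast Finset.card_le_card fun x hx => (Finset.mem_filter.1 hx).2
    split_ifs with h
    · have : 0 ≤ p * X.card / 2 := by have := not_lt.1 hp0; positivity
      linarith
    · have := not_le.1 h
      linarith
  have h5 : (∑ ω, ((X.filter (· ∈ D ω)).card : ℝ)) / Fintype.card Ω ≤
      p * X.card / 2 + X.card * uniformPr Ω A := by
    rw [uniformPr_eq_sum, div_le_iff₀ hc]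
    refine (Finset.sum_le_sum fun ω _ => h2 ω).trans ?_
    rw [Finset.sum_add_distrib, ← Finset.mul_sum]
    simp only [Finset.sum_const, Finset.card_univ, nsmul_eq_mul]
    field_simp
    exact le_refl _
  have h6 : X.card * (p / 2) ≤ X.card * uniformPr Ω A := by linarith
  exact le_of_mul_le_mul_left h6 hX'

end UniformPr

/-! ### Revealing one coordinate of a product space. -/

/-- Let `F` be an event of probability at least `1 / Q` in a product of `2 r` copies of `Ω`, where
`2 Q ≤ 2 ^ r`. For at least half of the coordinates `i` it is true that, with probability at least
`1/2`, revealing the coordinate `i` leaves `F` a conditional probability of at least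
`1 / (4 r Q)`. -/
theorem half_coordinates_good {Ω : Type*} [Finite Ω] [Nonempty Ω] {r : ℕ} (hr : 0 < r)
    (F : (Fin (2 * r) → Ω) → Prop) {Q : ℝ} (hQ : 0 < Q) (hQr : 2 * Q ≤ 2 ^ r)
    (hF : 1 / Q ≤ uniformPr (Fin (2 * r) → Ω) F) :
    1 / 2 ≤ uniformPr (Fin (2 * r)) fun i => 1 / 2 ≤ uniformPr Ω fun a =>
      1 / (4 * r * Q) ≤ uniformPr (Fin (2 * r) → Ω) fun b => F (Function.update b i a) := by
  classical
  cases nonempty_fintype Ω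
  set good : Fin (2 * r) → Ω → Prop := fun i a =>
    1 / (4 * r * Q) ≤ uniformPr (Fin (2 * r) → Ω) fun b => F (Function.update b i a) with hgood
  have hr' : (0 : ℝ) < r := by exact_mod_cast hr
  -- Reveal coordinate `i`: good values contribute nothing, and any other value leaves `F` less than
  -- `1 / (4rQ)`.
  have bad : ∀ i, uniformPr (Fin (2 * r) → Ω) (fun ω => F ω ∧ ¬ good i (ω i)) ≤
      1 / (4 * r * Q) := by
    intro i
    rw [← uniformPr_update i]
    refine uniformPr_prod_le
      (P := fun a b => F (Function.update b i a) ∧ ¬ good i (Function.update b i a i)) fun a => ?_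
    by_cases ha : good i a
    · simp only [Function.update_self, ha, not_true, and_false]
      simp only [uniformPr, Nat.card_of_isEmpty, Nat.cast_zero, zero_div]
      positivity
    · exact (uniformPr_mono fun b hb => hb.1).trans (not_le.1 ha).le
  -- On `F`, either all coordinates are good, which are independent events, or one of the `2r` is
  -- bad, which costs `2r / (4rQ) = 1 / (2Q)` in total.
  have key : 1 / Q ≤ (∏ i, uniformPr Ω (good i)) + 1 / (2 * Q) := by
    calc 1 / Q ≤ _ := hF
      _ ≤ uniformPr (Fin (2 * r) → Ω) (fun ω => (∀ i, good i (ω i)) ∨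
          ∃ i ∈ Finset.univ, F ω ∧ ¬ good i (ω i)) := by
        refine uniformPr_mono fun ω hω => ?_
        by_cases h : ∀ i, good i (ω i)
        · exact Or.inl h
        · push Not at h
          obtain ⟨i, hi⟩ := h
          exact Or.inr ⟨i, Finset.mem_univ _, hω, hi⟩
      _ ≤ _ := uniformPr_or_le _ _
      _ ≤ _ := by
        rw [uniformPr_pi]
        gcongr
        refine (uniformPr_exists_le _ _).trans ((Finset.sum_le_sum fun i _ => bad i).trans ?_)
        simp only [Finset.sum_const, Finset.card_univ, Fintype.card_fin, nsmul_eq_mul]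
        apply le_of_eq
        push_cast
        field_simp
        norm_num
  have hprod : 1 / 2 ^ r ≤ ∏ i, uniformPr Ω (good i) := by
    have h1 : 1 / Q = 1 / (2 * Q) + 1 / (2 * Q) := by field_simp; norm_num
    have h2 : 1 / (2 : ℝ) ^ r ≤ 1 / (2 * Q) := one_div_le_one_div_of_le (by positivity) hQr
    linarith
  -- With fewer than `r` coordinates likely to be good, at least `r + 1` factors of the product are
  -- below `1/2`, which contradicts `hprod`.
  by_contra hcon
  rw [not_le] at hcon
  set G := Finset.univ.filter fun i => 1 / 2 ≤ uniformPr Ω (good i) with hG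
  have hGr : G.card < r := by
    rw [uniformPr, Nat.card_eq_fintype_card, Nat.card_eq_fintype_card, Fintype.card_fin,
      Fintype.card_subtype, div_lt_iff₀ (by positivity)] at hcon
    push_cast at hcon
    exact_mod_cast (by linarith : (G.card : ℝ) < r)
  have hGc : r + 1 ≤ Gᶜ.card := by
    rw [Finset.card_compl, Fintype.card_fin]; omega
  have hle : ∏ i, uniformPr Ω (good i) ≤ (1 / 2) ^ (r + 1) := by
    rw [← Finset.prod_mul_prod_compl G]
    calc _ ≤ 1 * ∏ i ∈ Gᶜ, (1 / 2 : ℝ) := by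
          gcongr
          · exact Finset.prod_nonneg fun i _ => uniformPr_nonneg _
          · exact Finset.prod_le_one (fun i _ => uniformPr_nonneg _)
              fun i _ => uniformPr_le_one _
          · exact fun i _ => uniformPr_nonneg _
          · rename_i i hi
            simp only [hG, Finset.mem_compl, Finset.mem_filter, Finset.mem_univ, true_and,
              not_le] at hi
            exact hi.le
      _ = (1 / 2) ^ Gᶜ.card := by simp
      _ ≤ _ := pow_le_pow_of_le_one (by norm_num) (by norm_num) hGc
  have : (1 / 2 : ℝ) ^ (r + 1) < 1 / 2 ^ r := by
    rw [one_div_pow, pow_succ]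
    apply one_div_lt_one_div_of_lt (by positivity)
    have : (0 : ℝ) < 2 ^ r := by positivity
    linarith
  linarith

/-! ### Random prefixes and random labellings. -/

section Orders

variable {V : Type*} {S : Finset V} {N : ℕ}

/-- The set of elements that the ordering `π` of `S` lists at the positions in `X`. -/
def valuesAt (π : Fin N ≃ S) (X : Finset (Fin N)) : Finset V :=
  X.map (π.toEmbedding.trans (Function.Embedding.subtype _))

/-- The elements of `S` of label less than `k`. -/
def belowLabel (k : ℕ) (l : S → Fin N) : Finset V :=
  (Finset.univ.filter fun y => (l y : ℕ) < k).map (Function.Embedding.subtype _)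

/-- The first `k` positions. -/
def firstPositions (N k : ℕ) : Finset (Fin N) := Finset.univ.filter fun i => (i : ℕ) < k

theorem card_firstPositions {k : ℕ} (h : k ≤ N) : (firstPositions N k).card = k := by
  rw [firstPositions, Fin.card_filter_val_lt, min_eq_right h]

theorem exists_perm_map_eq {X Y : Finset (Fin N)} (h : X.card = Y.card) :
    ∃ σ : Equiv.Perm (Fin N), X.map σ.toEmbedding = Y := by
  classical
  let e : {i // i ∈ X} ≃ {i // i ∈ Y} := Fintype.equivOfCardEq (by simpa using h)
  refine ⟨e.extendSubtype, ?_⟩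
  apply Finset.eq_of_subset_of_card_le _ (by simp [h])
  intro y hy
  obtain ⟨x, hx, rfl⟩ := Finset.mem_map.1 hy
  exact e.extendSubtype_mem x hx

theorem uniformPr_valuesAt_eq (P : Finset V → Prop) {X Y : Finset (Fin N)}
    (h : X.card = Y.card) :
    uniformPr (Fin N ≃ S) (fun π => P (valuesAt π X)) =
      uniformPr (Fin N ≃ S) (fun π => P (valuesAt π Y)) := by
  obtain ⟨σ, rfl⟩ := exists_perm_map_eq h
  rw [← uniformPr_equiv (Equiv.equivCongr σ (Equiv.refl S))
    (fun π => P (valuesAt π (X.map σ.toEmbedding)))]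
  refine uniformPr_congr fun π => ?_
  have : valuesAt ((Equiv.equivCongr σ (Equiv.refl S)) π) (X.map σ.toEmbedding) =
      valuesAt π X := by
    rw [valuesAt, valuesAt, Finset.map_map]
    congr 1
    ext i
    simp
  rw [this]

/-- Random prefixes of length `j * a` are independent with probability at most that of `j`
independent random sets of size `a`. -/
theorem uniformPr_prefix_le_pow [Nonempty (Fin N ≃ S)] {P : Finset V → Prop}
    (hP : ∀ X Y, X ⊆ Y → P Y → P X) {a j : ℕ} (h : j * a ≤ N) :
    uniformPr (Fin N ≃ S) (fun π => P (valuesAt π (firstPositions N (j * a)))) ≤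
      uniformPr {T : Finset V // T ∈ S.powersetCard a} (fun T => P T.1) ^ j := by
  classical
  rcases Nat.eq_zero_or_pos j with rfl | hj
  · simpa using uniformPr_le_one _
  have haN : a ≤ N := (Nat.le_mul_of_pos_left a hj).trans h
  -- Couple the ordering with `j` independent random `a`-sets of positions. For a fixed ordering
  -- they list independent uniform `a`-subsets of `S`. For fixed position sets, their union lies in
  -- a set of `j * a` positions, which by exchangeability behaves like a prefix.
  let Ω := Fin j → {X : Finset (Fin N) // X ∈ Finset.univ.powersetCard a}
  have : Nonempty Ω := ⟨fun _ => ⟨firstPositions N a, by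
    simp [Finset.mem_powersetCard, card_firstPositions haN]⟩⟩
  set E : (Fin N ≃ S) → Ω → Prop := fun π X => ∀ i, P (valuesAt π (X i).1)
  have h1 : uniformPr ((Fin N ≃ S) × Ω) (fun z => E z.1 z.2) ≤
      uniformPr {T : Finset V // T ∈ S.powersetCard a} (fun T => P T.1) ^ j := by
    refine uniformPr_prod_le fun π => ?_
    have h2 := uniformPr_pi (κ := Fin j)
      (fun (_ : Fin j) (X : {X : Finset (Fin N) // X ∈ Finset.univ.powersetCard a}) =>
        P (valuesAt π X.1))
    refine h2.trans_le ?_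
    rw [Finset.prod_const, Finset.card_univ, Fintype.card_fin]
    apply le_of_eq
    congr 1
    let f : {X : Finset (Fin N) // X ∈ Finset.univ.powersetCard a} →
        {T : Finset V // T ∈ S.powersetCard a} := fun X => ⟨valuesAt π X.1, by
      have := (Finset.mem_powersetCard.1 X.2).2
      rw [Finset.mem_powersetCard, valuesAt, Finset.card_map]
      refine ⟨fun y hy => ?_, this⟩
      obtain ⟨x, _, rfl⟩ := Finset.mem_map.1 hy
      exact (π x).2⟩
    have hf : f.Bijective := by
      constructor
      · intro X Y hXY
        exact Subtype.ext (Finset.map_injective _ (congrArg Subtype.val hXY))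
      · rintro ⟨T, hT⟩
        rw [Finset.mem_powersetCard] at hT
        have hS : ∀ T : Finset V, T ⊆ S →
            ((T.subtype (· ∈ S)).map π.symm.toEmbedding).map
              (π.toEmbedding.trans (Function.Embedding.subtype _)) = T := by
          intro T hT
          ext v
          simp only [Finset.mem_map, Finset.mem_subtype]
          constructor
          · rintro ⟨_, ⟨y, hy, rfl⟩, rfl⟩
            simpa using hy
          · exact fun hv => ⟨_, ⟨⟨v, hT hv⟩, hv, rfl⟩, by simp⟩
        refine ⟨⟨(T.subtype (· ∈ S)).map π.symm.toEmbedding, ?_⟩, Subtype.ext (hS T hT.1)⟩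
        rw [Finset.mem_powersetCard]
        refine ⟨Finset.subset_univ _, ?_⟩
        rw [← hT.2, ← Finset.card_map (π.toEmbedding.trans (Function.Embedding.subtype _)),
          hS T hT.1]
    exact uniformPr_equiv (Equiv.ofBijective f hf) fun T => P T.1
  refine le_trans ?_ h1
  rw [uniformPr_prod_comm E]
  have h2 := mul_le_uniformPr_prod (α := Ω) (β := Fin N ≃ S) (A := fun _ => True)
    (P := fun X π => E π X) (p := 1)
    (q := uniformPr (Fin N ≃ S) (fun π => P (valuesAt π (firstPositions N (j * a)))))
    (uniformPr_nonneg _) (uniformPr_of_forall fun _ => trivial).ge ?_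
  · rwa [one_mul] at h2
  · intro X _
    obtain ⟨Y, hXY, hY⟩ := Finset.exists_superset_card_eq
      (s := Finset.univ.biUnion fun i => (X i).1) (n := j * a) (by
        refine (Finset.card_biUnion_le_card_mul _ _ a fun i _ =>
          (Finset.mem_powersetCard.1 (X i).2).2.le).trans ?_
        simp) (by simpa using h)
    rw [uniformPr_valuesAt_eq P (Y := Y) (by rw [hY, card_firstPositions h])]
    refine uniformPr_mono fun π hπ i => hP _ _ ?_ hπ
    exact Finset.map_subset_map.2 ((Finset.subset_biUnion_of_mem (fun i => (X i).1)
      (Finset.mem_univ i)).trans hXY)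

/-- The binomial distribution with `N` trials of mean `k` takes the value `k` with probability at
least `1 / (N + 1)`. -/
theorem pow_le_succ_mul_choose_mul {N k : ℕ} (hk : k ≤ N) :
    N ^ N ≤ (N + 1) * (N.choose k * (k ^ k * (N - k) ^ (N - k))) := by
  set a : ℕ → ℕ := fun i => N.choose i * (k ^ i * (N - k) ^ (N - i)) with ha
  -- The ratio of consecutive binomial terms shows that they increase up to `k` and decrease after
  -- it. So the term at `k` is the largest of the `N + 1` terms, whose sum is `N ^ N`.
  have hstep : ∀ i < N, (i + 1) * (N - k) * a (i + 1) = (N - i) * k * a i := by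
    intro i hi
    obtain ⟨d, hd⟩ : ∃ d, N - i = d + 1 := ⟨N - i - 1, by omega⟩
    have h1 : N - (i + 1) = d := by omega
    have h2 := Nat.choose_succ_right_eq N i
    simp only [ha]
    rw [h1, hd]
    rw [hd] at h2
    calc _ = (N.choose (i + 1) * (i + 1)) * (k ^ (i + 1) * (N - k) ^ (d + 1)) := by ring
      _ = _ := by rw [h2]; ring
  have hup : ∀ i, i < k → a i ≤ a (i + 1) := by
    intro i hi
    rcases eq_or_lt_of_le hk with rfl | hkN
    · simp only [ha, Nat.sub_self]
      rw [zero_pow (by omega)]; simp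
    have h0 : 0 < (i + 1) * (N - k) := Nat.mul_pos (by omega) (by omega)
    refine Nat.le_of_mul_le_mul_left ?_ h0
    rw [hstep i (by omega)]
    refine Nat.mul_le_mul_right _ ?_
    obtain ⟨e, rfl⟩ := Nat.exists_eq_add_of_lt hi
    obtain ⟨f, rfl⟩ := Nat.exists_eq_add_of_lt hkN
    have e1 : i + e + 1 + f + 1 - (i + e + 1) = f + 1 := by omega
    have e2 : i + e + 1 + f + 1 - i = e + f + 2 := by omega
    rw [e1, e2]
    nlinarith [Nat.zero_le (e * f), Nat.zero_le (i * e), Nat.zero_le (e * e)]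
  have hdown : ∀ i, k ≤ i → i < N → a (i + 1) ≤ a i := by
    intro i hi hiN
    have h0 : 0 < (i + 1) * (N - k) := Nat.mul_pos (by omega) (by omega)
    refine Nat.le_of_mul_le_mul_left ?_ h0
    rw [hstep i (by omega)]
    refine Nat.mul_le_mul_right _ ?_
    obtain ⟨e, rfl⟩ := Nat.exists_eq_add_of_le hi
    obtain ⟨f, rfl⟩ := Nat.exists_eq_add_of_lt hiN
    have e1 : k + e + f + 1 - k = e + f + 1 := by omega
    have e2 : k + e + f + 1 - (k + e) = f + 1 := by omega
    rw [e1, e2]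
    nlinarith [Nat.zero_le (e * f), Nat.zero_le (k * e), Nat.zero_le (e * e)]
  have hmax : ∀ i ≤ N, a i ≤ a k := by
    intro i hi
    rcases le_total i k with h | h
    · obtain ⟨e, rfl⟩ := Nat.exists_eq_add_of_le h
      have : ∀ e', e' ≤ e → a i ≤ a (i + e') := by
        intro e'
        induction e' with
        | zero => intro _; exact le_refl _
        | succ e' ih => intro he; exact (ih (by omega)).trans (hup _ (by omega))
      exact this e le_rfl
    · obtain ⟨e, rfl⟩ := Nat.exists_eq_add_of_le h
      have : ∀ e', e' ≤ e → a (k + e') ≤ a k := by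
        intro e'
        induction e' with
        | zero => intro _; exact le_refl _
        | succ e' ih => intro he; exact (hdown (k + e') (by omega) (by omega)).trans (ih (by omega))
      exact this e le_rfl
  calc N ^ N = (k + (N - k)) ^ N := by rw [Nat.add_sub_cancel' hk]
    _ = ∑ i ∈ Finset.range (N + 1), a i := by
      rw [add_pow]
      exact Finset.sum_congr rfl fun i _ => by simp only [ha]; push_cast; ring
    _ ≤ ∑ i ∈ Finset.range (N + 1), a k :=
      Finset.sum_le_sum fun i hi => hmax i (by simpa [Nat.lt_succ_iff] using hi)
    _ = _ := by simp [ha]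

theorem uniformPr_card_below_eq {k : ℕ} (hk : k ≤ N) :
    1 / (N + 1 : ℝ) ≤ uniformPr (Fin N → Fin N) fun l =>
      (Finset.univ.filter fun i => (l i : ℕ) < k).card = k := by
  classical
  rw [uniformPr, Nat.card_eq_fintype_card, Nat.card_eq_fintype_card, Fintype.card_subtype]
  have h1 : N.choose k * (k ^ k * (N - k) ^ (N - k)) ≤
      (Finset.univ.filter fun l : Fin N → Fin N =>
        (Finset.univ.filter fun i => (l i : ℕ) < k).card = k).card := by
    rw [Finset.card_eq_sum_card_fiberwise
      (f := fun l : Fin N → Fin N => Finset.univ.filter fun i => (l i : ℕ) < k)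
      (t := Finset.univ.powersetCard k)
      (fun l hl => by
        simp only [Finset.coe_filter, Finset.mem_univ, true_and, Set.mem_ofPred_eq] at hl
        simp [Finset.mem_powersetCard, hl])]
    have hc : ((Finset.univ : Finset (Fin N)).powersetCard k).card = N.choose k := by simp
    rw [← hc, ← smul_eq_mul, ← Finset.sum_const]
    refine Finset.sum_le_sum fun T hT => ?_
    have hT := (Finset.mem_powersetCard.1 hT).2
    have hpi : (Fintype.piFinset fun i : Fin N =>
        if i ∈ T then firstPositions N k else (firstPositions N k)ᶜ).card =
        k ^ k * (N - k) ^ (N - k) := by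
      rw [Fintype.card_piFinset, ← Finset.prod_mul_prod_compl T]
      congr 1
      · rw [Finset.prod_congr rfl fun i hi => by rw [if_pos hi, card_firstPositions hk],
          Finset.prod_const, hT]
      · rw [Finset.prod_congr rfl fun i hi => by
          rw [if_neg (Finset.mem_compl.1 hi), Finset.card_compl, card_firstPositions hk,
            Fintype.card_fin], Finset.prod_const, Finset.card_compl, hT, Fintype.card_fin]
    rw [← hpi]
    refine Finset.card_le_card fun l hl => ?_
    rw [Fintype.mem_piFinset] at hl
    have hlT : (Finset.univ.filter fun i => (l i : ℕ) < k) = T := by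
      ext i
      have := hl i
      by_cases hi : i ∈ T
      · simpa [hi, firstPositions] using this
      · simpa [hi, firstPositions] using this
    simp [hlT, hT]
  rcases Nat.eq_zero_or_pos N with rfl | hN
  · simp at hk; subst hk; simp
  rw [Fintype.card_fun, Fintype.card_fin,
    div_le_div_iff₀ (by positivity) (by positivity), one_mul]
  have h2 := (pow_le_succ_mul_choose_mul hk).trans (Nat.mul_le_mul_left _ h1)
  rw [mul_comm]
  exact_mod_cast h2

/-- Comparison of a random prefix with the random set of elements of small label. -/
theorem uniformPr_prefix_le_label [Nonempty (Fin N ≃ S)] [Nonempty (Fin N → Fin N)]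
    (P : Finset V → Prop) {k : ℕ} (hk : k ≤ N) :
    1 / (N + 1 : ℝ) * uniformPr (Fin N ≃ S) (fun π => P (valuesAt π (firstPositions N k))) ≤
      uniformPr (S → Fin N) (fun l => P (belowLabel k l)) := by
  classical
  -- Put the labels on positions. When exactly `k` of them are below `k`, exchangeability makes the
  -- listed set distributed as the prefix. Labels are preferred to orderings because their
  -- coordinates are independent.
  set E : (Fin N ≃ S) → (Fin N → Fin N) → Prop := fun π l =>
    P (valuesAt π (Finset.univ.filter fun i => (l i : ℕ) < k))
  have h1 : uniformPr ((Fin N ≃ S) × (Fin N → Fin N)) (fun z => E z.1 z.2) ≤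
      uniformPr (S → Fin N) (fun l => P (belowLabel k l)) := by
    refine uniformPr_prod_le fun π => le_of_eq ?_
    rw [← uniformPr_equiv (π.arrowCongr (Equiv.refl (Fin N)))]
    refine uniformPr_congr fun l => ?_
    have : belowLabel k ((π.arrowCongr (Equiv.refl (Fin N))) l) =
        valuesAt π (Finset.univ.filter fun i => (l i : ℕ) < k) := by
      ext v
      simp only [belowLabel, valuesAt, Finset.mem_map, Finset.mem_filter, Finset.mem_univ,
        true_and]
      constructor
      · rintro ⟨y, hy, rfl⟩
        exact ⟨π.symm y, by simpa using hy, by simp⟩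
      · rintro ⟨i, hi, rfl⟩
        exact ⟨π i, by simpa using hi, rfl⟩
    rw [this]
  refine le_trans ?_ h1
  rw [uniformPr_prod_comm E]
  refine mul_le_uniformPr_prod (P := fun l π => E π l) (uniformPr_nonneg _)
    (uniformPr_card_below_eq hk) fun l hl => ?_
  exact (uniformPr_valuesAt_eq P (by rw [hl, card_firstPositions hk])).le

end Orders

/-! ### First circuits of random orderings. -/

section MatroidOrders

variable {V : Type u} {S : Finset V}

/-- `T` is independent, and becomes dependent when `x` is added. -/
def Spans (M : Matroid V) (x : V) (T : Finset V) : Prop :=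
  M.Indep (T : Set V) ∧ ¬ M.Indep (insert x (T : Set V))

theorem coe_valuesAt_firstPositions {N : ℕ} (π : Fin N ≃ S) (k : ℕ) :
    (valuesAt π (firstPositions N k) : Set V) = {v | ∃ i : Fin N, (i : ℕ) < k ∧ (π i : V) = v} := by
  ext v
  simp [valuesAt, firstPositions]

theorem valuesAt_firstPositions_mono {N : ℕ} (π : Fin N ≃ S) {k l : ℕ} (h : k ≤ l) :
    valuesAt π (firstPositions N k) ⊆ valuesAt π (firstPositions N l) := by
  refine Finset.map_subset_map.2 fun i hi => ?_
  simp only [firstPositions, Finset.mem_filter, Finset.mem_univ, true_and] at hi ⊢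
  omega

/-- If the first circuit is completed at position `k` and contains `x`, then exchanging `x` with the
element at position `k` yields an ordering in which `x` completes it. -/
theorem spans_of_swap {M : Matroid V} (hS : (S : Set V) ⊆ M.E) {N k : ℕ} (hk : k < N)
    (π : Fin N ≃ S) (x : S) {C : Set V} (hC : M.IsCircuit C) (hx : (x : V) ∈ C)
    (hI : M.Indep (valuesAt π (firstPositions N k) : Set V))
    (hCk : C ⊆ (valuesAt π (firstPositions N (k + 1)) : Set V)) :
    Spans M x (valuesAt ((Equiv.swap ⟨k, hk⟩ (π.symm x)).trans π) (firstPositions N k)) := by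
  set p := π.symm x with hp
  set y : V := (π ⟨k, hk⟩ : V) with hy
  set I : Set V := (valuesAt π (firstPositions N k) : Set V) with hIdef
  have hmem : ∀ v, v ∈ I ↔ ∃ i : Fin N, (i : ℕ) < k ∧ (π i : V) = v := fun v => by
    rw [hIdef, coe_valuesAt_firstPositions]; rfl
  have hsucc : (valuesAt π (firstPositions N (k + 1)) : Set V) = insert y I := by
    ext v
    rw [coe_valuesAt_firstPositions, Set.mem_insert_iff, hmem]
    constructor
    · rintro ⟨i, hi, rfl⟩
      rcases Nat.lt_succ_iff_lt_or_eq.1 hi with h | h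
      · exact Or.inr ⟨i, h, rfl⟩
      · left; rw [hy]; congr; exact Fin.ext h
    · rintro (rfl | ⟨i, hi, rfl⟩)
      · exact ⟨⟨k, hk⟩, Nat.lt_succ_self k, rfl⟩
      · exact ⟨i, by omega, rfl⟩
  rw [hsucc] at hCk
  have hyI : y ∉ I := by
    rw [hmem]
    rintro ⟨i, hi, h⟩
    have := π.injective (Subtype.ext h)
    subst this
    exact absurd hi (lt_irrefl _)
  have hinj : ∀ i, (π i : V) = x → i = p := fun i h => by
    rw [hp, Equiv.eq_symm_apply]; exact Subtype.ext h
  have hpx : (π p : V) = x := by simp [hp]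
  have hpk : (p : ℕ) ≤ k := by
    have h := hCk hx
    rw [← hsucc, coe_valuesAt_firstPositions] at h
    obtain ⟨i, hi, h⟩ := h
    rw [← hinj i h]; omega
  -- This includes the case `x = y`, where the swap is trivial and both sides are `I`.
  have hset : (valuesAt ((Equiv.swap ⟨k, hk⟩ p).trans π) (firstPositions N k) : Set V) =
      insert y I \ {(x : V)} := by
    rw [← hsucc]
    ext v
    rw [coe_valuesAt_firstPositions, Set.mem_sdiff, coe_valuesAt_firstPositions]
    constructor
    · rintro ⟨i, hi, rfl⟩
      have hik : i ≠ ⟨k, hk⟩ := fun h => by subst h; exact absurd hi (lt_irrefl _)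
      by_cases hip : i = p
      · subst hip
        refine ⟨⟨⟨k, hk⟩, Nat.lt_succ_self k, by simp⟩, fun h => hik ?_⟩
        have := hinj _ h
        simpa using this.symm
      · rw [Equiv.trans_apply, Equiv.swap_apply_of_ne_of_ne hik hip]
        exact ⟨⟨i, by omega, rfl⟩, fun h => hip (hinj i h)⟩
    · rintro ⟨⟨i, hi, rfl⟩, hix⟩
      have hip : i ≠ p := fun h => hix (by rw [h, hpx]; rfl)
      by_cases hik : i = ⟨k, hk⟩
      · subst hik
        refine ⟨p, lt_of_le_of_ne hpk fun h => hip (Fin.ext h.symm), by simp⟩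
      · refine ⟨i, lt_of_le_of_ne (Nat.lt_succ_iff.1 hi) fun h => hik (Fin.ext h), ?_⟩
        rw [Equiv.trans_apply, Equiv.swap_apply_of_ne_of_ne hik hip]
  have hyE : y ∈ M.E := hS (π ⟨k, hk⟩).2
  have hdep : ¬ M.Indep (insert y I) := fun h => hC.dep.not_indep (h.subset hCk)
  refine ⟨?_, ?_⟩
  · rw [hset]
    -- `C` is the fundamental circuit of `y` over `I`, so exchanging any of its elements, in
    -- particular `x`, for `y` keeps independence.
    have hcl : y ∈ M.closure I := by
      rw [hI.mem_closure_iff_of_notMem hyI]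
      exact ⟨hdep, Set.insert_subset hyE hI.subset_ground⟩
    rw [← hI.mem_fundCircuit_iff hcl hyI, ← hC.eq_fundCircuit_of_subset hI hCk]
    exact hx
  · rw [hset, Set.insert_sdiff_singleton, Set.insert_eq_of_mem (hCk hx)]
    exact hdep

theorem hittingProb_restrict (M : Matroid V) (hS : (S : Set V) ⊆ M.E) (T : Set V) :
    hittingProb (M.restrict (S : Set V)) T = uniformPr (Fin S.card ≃ S) fun π =>
      ∃ (k : ℕ) (C : Set V), M.Indep (valuesAt π (firstPositions S.card k) : Set V) ∧
        M.IsCircuit C ∧ C ⊆ (valuesAt π (firstPositions S.card (k + 1)) : Set V) ∧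
        (T ∩ C).Nonempty := by
  have hN : (M.restrict (S : Set V)).E.ncard = S.card := Set.ncard_coe_finset S
  let e : GroundOrder (M.restrict (S : Set V)) ≃ (Fin S.card ≃ S) :=
    Equiv.equivCongr (finCongr hN) (Equiv.refl S)
  rw [hittingProb, ← uniformPr_equiv e]
  refine uniformPr_congr fun π => ?_
  have hpre : ∀ k, (valuesAt (e π) (firstPositions S.card k) : Set V) = orderPrefix π k := by
    intro k
    rw [coe_valuesAt_firstPositions]
    ext v
    constructor
    · rintro ⟨i, hi, rfl⟩
      exact ⟨(finCongr hN).symm i, hi, rfl⟩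
    · rintro ⟨i, hi, rfl⟩
      exact ⟨finCongr hN i, hi, rfl⟩
  have hsub : ∀ k, orderPrefix π k ⊆ (S : Set V) := by
    rintro k _ ⟨i, _, rfl⟩
    exact (π i).2
  simp_rw [hpre]
  constructor
  · rintro ⟨C, ⟨k, hI, hC, hCk⟩, hT⟩
    exact ⟨k, C, hI.of_restrict, ((Matroid.restrict_isCircuit_iff hS).1 hC).1, hCk, hT⟩
  · rintro ⟨k, C, hI, hC, hCk, hT⟩
    exact ⟨C, ⟨k, Matroid.restrict_indep_iff.2 ⟨hI, hsub k⟩,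
      (Matroid.restrict_isCircuit_iff hS).2 ⟨hC, hCk.trans (hsub _)⟩, hCk⟩, hT⟩

/-- From the circuit mass bound only its positivity is needed. -/
theorem IsGloballyOptimal.exists_isCircuit {M : Matroid V} (h : IsGloballyOptimal M S) :
    ∃ C, M.IsCircuit C ∧ C ⊆ (S : Set V) := by
  by_contra hcon
  have : circuitMass M (S : Set V) = 0 := by
    rw [circuitMass, uniformPr]
    have : IsEmpty {π : GroundOrder M // ∃ C, IsFirstCircuit M π C ∧ C ⊆ (S : Set V)} :=
      ⟨fun ⟨π, C, ⟨_, _, hC, _⟩, hCS⟩ => hcon ⟨C, hC, hCS⟩⟩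
    simp
  have h2 := h.mass
  rw [this] at h2
  norm_num at h2

theorem indepProb_circuitMedian_le {M : Matroid V} (hdep : ¬ M.Indep (S : Set V)) :
    indepProb M S (circuitMedian M S) ≤ 1 / 2 := by
  -- The infimum is attained, and is not the default value `0` of an empty set, because `S` itself
  -- is dependent.
  refine (Nat.sInf_mem (s := {k | k ≤ S.card ∧ indepProb M S k ≤ 1 / 2}) ⟨S.card, le_rfl, ?_⟩).2
  rw [indepProb, uniformPr]
  have : IsEmpty {T : {T : Finset V // T ∈ S.powersetCard S.card} // M.Indep (T.1 : Set V)} := by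
    refine ⟨fun T => hdep ?_⟩
    obtain ⟨⟨T, hT⟩, hI⟩ := T
    rw [Finset.powersetCard_self, Finset.mem_singleton] at hT
    exact hT ▸ hI
  simp

/-- The probability that a circuit completed at position `k` contains `x` is at most `N` times the
probability that the first `k` elements are independent and span `x`. -/
theorem uniformPr_circuit_mem_le {M : Matroid V} (hS : (S : Set V) ⊆ M.E) {N k : ℕ} (hk : k < N)
    (x : S) :
    uniformPr (Fin N ≃ S) (fun π => ∃ C : Set V, M.IsCircuit C ∧ (x : V) ∈ C ∧
        M.Indep (valuesAt π (firstPositions N k) : Set V) ∧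
        C ⊆ (valuesAt π (firstPositions N (k + 1)) : Set V)) ≤
      N * uniformPr (Fin N ≃ S) (fun π => Spans M x (valuesAt π (firstPositions N k))) := by
  -- The factor `N` is a union bound over the position `p` of `x`; for fixed `p` the transposed
  -- ordering is again uniform.
  calc _ ≤ uniformPr (Fin N ≃ S) (fun π => ∃ p ∈ (Finset.univ : Finset (Fin N)),
        Spans M x (valuesAt ((Equiv.swap ⟨k, hk⟩ p).trans π) (firstPositions N k))) := by
        refine uniformPr_mono fun π => ?_
        rintro ⟨C, hC, hx, hI, hCk⟩
        exact ⟨π.symm x, Finset.mem_univ _, spans_of_swap hS hk π x hC hx hI hCk⟩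
    _ ≤ _ := uniformPr_exists_le _ _
    _ = ∑ _p : Fin N, uniformPr (Fin N ≃ S)
          (fun π => Spans M x (valuesAt π (firstPositions N k))) := by
        refine Finset.sum_congr rfl fun p _ => ?_
        rw [← uniformPr_equiv (Equiv.equivCongr (Equiv.swap ⟨k, hk⟩ p) (Equiv.refl S))
          (fun π => Spans M x (valuesAt π (firstPositions N k)))]
        refine uniformPr_congr fun π => ?_
        have : Equiv.equivCongr (Equiv.swap ⟨k, hk⟩ p) (Equiv.refl S) π =
            (Equiv.swap ⟨k, hk⟩ p).trans π := by ext i; simp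
        rw [this]
    _ = _ := by simp

/-- This is the origin of the threshold `2 ^ 64` on `n`: it puts `2 ^ (-(l / 2))` below half of the
hitting bound `1 / (2 ^ 22 * (l + 1))`. -/
theorem two_pow_mul_succ_le {l : ℕ} (hl : 64 ≤ l) : 2 ^ 23 * (l + 1) ≤ 2 ^ (l / 2) := by
  have key : ∀ t, 2 ^ 23 * (2 * (t + 32) + 2) ≤ 2 ^ (t + 32) := by
    intro t
    induction t with
    | zero => norm_num
    | succ t ih =>
      have : 2 ^ (t + 1 + 32) = 2 * 2 ^ (t + 32) := by ring
      omega
  have h := key (l / 2 - 32)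
  rw [Nat.sub_add_cancel (by omega)] at h
  refine le_trans (Nat.mul_le_mul_left _ ?_) h
  omega

/-- At least half of the elements `x` of a globally optimal set are spanned with polynomially large
probability by the independent random set of elements of label less than some `k < |S| / 2`. -/
theorem IsGloballyOptimal.card_spanned {M : Matroid V} (h : IsGloballyOptimal M S) {n : ℕ}
    (hn : M.E.ncard = n) (hn' : 2 ^ 64 ≤ n) (hSn : S.card ≤ n)
    (hα : (circuitMedian M S : ℝ) / (S.card : ℝ) < 1 / Real.logb 2 (n : ℝ)) :
    ∃ X : Finset S, S.card ≤ 2 * X.card ∧ ∀ x ∈ X, ∃ k < S.card / 2,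
      1 / (n : ℝ) ^ 7 ≤ uniformPr (S → Fin S.card) fun l => Spans M x (belowLabel k l) := by
  classical
  obtain ⟨C₀, hC₀, hC₀S⟩ := h.exists_isCircuit
  have hS := h.subset_ground
  have hdep : ¬ M.Indep (S : Set V) := fun hI => hC₀.dep.not_indep (hI.subset hC₀S)
  have hN : 0 < S.card := by
    obtain ⟨x, hx⟩ := hC₀.nonempty
    exact Finset.card_pos.2 ⟨x, hC₀S hx⟩
  have hNR : (0 : ℝ) < S.card := by exact_mod_cast hN
  set N := S.card with hNdef
  have : Nonempty (Fin N ≃ S) := ⟨S.equivFin.symm⟩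
  have : Nonempty (Fin N) := ⟨⟨0, hN⟩⟩
  set α := circuitMedian M S with hαdef
  set l := Nat.log 2 n with hl
  have hnpos : 0 < n := lt_of_lt_of_le (by positivity) hn'
  have hnR : (1 : ℝ) ≤ n := by exact_mod_cast hnpos
  have hl64 : 64 ≤ l := (Nat.le_log_iff_pow_le (by norm_num) hnpos.ne').2 hn'
  have hln : 2 ^ l ≤ n := Nat.pow_log_le_self 2 hnpos.ne'
  have hlR : (64 : ℝ) ≤ l := by exact_mod_cast hl64
  have hlog : (l : ℝ) ≤ Real.logb 2 n := by exact_mod_cast Real.natLog_le_logb n 2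
  have hlog' : Real.logb 2 n ≤ l + 1 := by
    rw [Real.logb_le_iff_le_rpow (by norm_num) (by linarith)]
    exact_mod_cast (Nat.lt_pow_succ_log_self (b := 2) (by norm_num) n).le
  have hαl : l / 2 * α ≤ N / 2 := by
    have h1 : (α : ℝ) / N ≤ 1 / l :=
      hα.le.trans (one_div_le_one_div_of_le (by linarith) hlog)
    rw [div_le_div_iff₀ hNR (by linarith)] at h1
    have h2 : α * l ≤ 1 * N := by exact_mod_cast h1
    rw [Nat.le_div_iff_mul_le (by norm_num)]
    calc l / 2 * α * 2 = α * (l / 2 * 2) := by ring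
      _ ≤ α * l := Nat.mul_le_mul_left _ (Nat.div_mul_le_self l 2)
      _ ≤ N := by omega
  set good : V → Prop := fun x => ∃ k < N / 2,
    1 / (n : ℝ) ^ 7 ≤ uniformPr (S → Fin N) fun l => Spans M x (belowLabel k l) with hgood
  refine ⟨Finset.univ.filter fun x : S => good x, ?_, fun x hx => (Finset.mem_filter.1 hx).2⟩
  by_contra hcon
  rw [not_le] at hcon
  -- If at least half of the elements were exceptional, global optimality would force the first
  -- circuit to hit them with probability at least `1 / (2 ^ 22 * (l + 1))`.
  set T : Finset S := (Finset.univ.filter fun x : S => good x)ᶜ with hT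
  have hTN : N ≤ 2 * T.card := by
    rw [hT, Finset.card_compl, Fintype.card_coe]
    omega
  have hTN' : T.card ≤ N := by
    simpa [hNdef] using Finset.card_le_univ T
  have hhit := h.hitting (T.map (Function.Embedding.subtype _)) (by
    intro x hx
    obtain ⟨y, _, rfl⟩ := Finset.mem_map.1 hx
    exact y.2)
  rw [hittingProb_restrict M hS, hn, Finset.card_map] at hhit
  have hle : uniformPr (Fin N ≃ S) (fun π =>
      ∃ (k : ℕ) (C : Set V), M.Indep (valuesAt π (firstPositions N k) : Set V) ∧
        M.IsCircuit C ∧ C ⊆ (valuesAt π (firstPositions N (k + 1)) : Set V) ∧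
        (((T.map (Function.Embedding.subtype _) : Finset V) : Set V) ∩ C).Nonempty) ≤
      (1 / 2) ^ (l / 2) + N * N * (N * ((N + 1) * (1 / (n : ℝ) ^ 7))) := by
    -- Either the first `l / 2 * α` elements are still independent, or the first circuit is
    -- completed within the first half and contains an exceptional element.
    calc _ ≤ uniformPr (Fin N ≃ S) (fun π =>
          M.Indep (valuesAt π (firstPositions N (l / 2 * α)) : Set V) ∨
          ∃ z ∈ T ×ˢ Finset.range (N / 2), ∃ C : Set V, M.IsCircuit C ∧ (z.1 : V) ∈ C ∧
            M.Indep (valuesAt π (firstPositions N z.2) : Set V) ∧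
            C ⊆ (valuesAt π (firstPositions N (z.2 + 1)) : Set V)) := by
          refine uniformPr_mono fun π => ?_
          rintro ⟨k, C, hI, hC, hCk, v, hvT, hvC⟩
          rw [or_iff_not_imp_left]
          intro hd
          obtain ⟨x, hx, rfl⟩ := Finset.mem_map.1 (Finset.mem_coe.1 hvT)
          have hk : k < l / 2 * α := by
            by_contra hk
            exact hd (hI.subset (Finset.coe_subset.2
              (valuesAt_firstPositions_mono π (not_lt.1 hk))))
          exact ⟨(x, k), Finset.mem_product.2 ⟨hx, Finset.mem_range.2 (hk.trans_le hαl)⟩,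
            C, hC, hvC, hI, hCk⟩
      _ ≤ _ := uniformPr_or_le _ _
      _ ≤ _ := by
        refine add_le_add ?_ ?_
        · refine (uniformPr_prefix_le_pow (P := fun X : Finset V => M.Indep (X : Set V))
            (fun X Y hXY hY => hY.subset (Finset.coe_subset.2 hXY))
            (hαl.trans (Nat.div_le_self _ _))).trans ?_
          exact pow_le_pow_left₀ (uniformPr_nonneg _) (indepProb_circuitMedian_le hdep) _
        · refine (uniformPr_exists_le _ _).trans ?_
          calc _ ≤ ∑ z ∈ T ×ˢ Finset.range (N / 2), N * ((N + 1) * (1 / (n : ℝ) ^ 7)) := by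
                refine Finset.sum_le_sum fun z hz => ?_
                rw [Finset.mem_product, Finset.mem_range] at hz
                refine (uniformPr_circuit_mem_le hS (hz.2.trans_le (Nat.div_le_self _ _))
                  z.1).trans ?_
                gcongr
                have h1 := uniformPr_prefix_le_label (N := N) (S := S) (Spans M (z.1 : V))
                  (k := z.2) (hz.2.le.trans (Nat.div_le_self _ _))
                have h2 : ¬ good z.1 := fun hg =>
                  Finset.mem_compl.1 hz.1 (Finset.mem_filter.2 ⟨Finset.mem_univ _, hg⟩)
                simp only [hgood, not_exists, not_and, not_le] at h2
                have h3 := h1.trans (h2 z.2 hz.2).le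
                rw [one_div, inv_mul_le_iff₀ (by positivity)] at h3
                exact h3
            _ = (T.card * (N / 2 : ℕ) : ℝ) * (N * ((N + 1) * (1 / (n : ℝ) ^ 7))) := by
                rw [Finset.sum_const, Finset.card_product, Finset.card_range, nsmul_eq_mul]
                push_cast
                ring
            _ ≤ _ := by
                gcongr
                exact Nat.div_le_self _ _
  have hlow : 1 / (2 ^ 22 * (l + 1 : ℝ)) ≤
      T.card / (2 ^ 21 * (N : ℝ) * Real.logb 2 (n : ℝ)) := by
    have hTN2 : (N : ℝ) ≤ 2 * T.card := by exact_mod_cast hTN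
    have hlog0 : 0 < Real.logb 2 (n : ℝ) := by linarith
    rw [div_le_div_iff₀ (by positivity) (by positivity)]
    calc 1 * (2 ^ 21 * (N : ℝ) * Real.logb 2 (n : ℝ)) ≤
        1 * (2 ^ 21 * (2 * T.card) * (l + 1)) := by gcongr
      _ = _ := by ring
  have hpow : (1 / 2 : ℝ) ^ (l / 2) ≤ 1 / (2 ^ 23 * (l + 1)) := by
    rw [one_div_pow]
    apply one_div_le_one_div_of_le (by positivity)
    exact_mod_cast two_pow_mul_succ_le hl64
  -- The exponent `7` beats the four factors lost to union bounds and to the passage to labels,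
  -- leaving `2 / n ^ 3`.
  have hsmall : N * N * (N * ((N + 1) * (1 / (n : ℝ) ^ 7))) < 1 / (2 ^ 23 * (l + 1 : ℝ)) := by
    have hNn : (N : ℝ) ≤ n := by exact_mod_cast hSn
    have hln2 : (2 : ℝ) ^ 23 * (l + 1) ≤ n := by
      have h1 : 2 ^ (l / 2) ≤ 2 ^ l := Nat.pow_le_pow_right (by norm_num) (Nat.div_le_self _ _)
      exact_mod_cast (two_pow_mul_succ_le hl64).trans (h1.trans hln)
    have hn2 : (2 : ℝ) < n := by
      have : 2 < n := lt_of_lt_of_le (by norm_num) hn'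
      exact_mod_cast this
    calc N * N * (N * ((N + 1) * (1 / (n : ℝ) ^ 7)))
        ≤ n * n * (n * ((n + n) * (1 / (n : ℝ) ^ 7))) := by gcongr
      _ = 2 / (n : ℝ) ^ 3 := by field_simp; ring
      _ < 1 / n := by
        rw [div_lt_div_iff₀ (by positivity) (by positivity)]
        nlinarith [mul_pos (show (0 : ℝ) < n by linarith) (show (0 : ℝ) < n by linarith)]
      _ ≤ _ := one_div_le_one_div_of_le (by positivity) hln2
  have hfin : 1 / (2 ^ 22 * (l + 1 : ℝ)) =
      1 / (2 ^ 23 * (l + 1)) + 1 / (2 ^ 23 * (l + 1)) := by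
    field_simp
    norm_num
  linarith [hhit, hle]

end MatroidOrders

/-! ### Detecting one element in one trial. -/

section Trial

/-- The labelling of `ι` which is `a` on the colour class `i` and is given by `b` on the
others. -/
def mixLabel {ι Λ : Type*} {m : ℕ} (χ : ι → Fin m) (i : Fin m) (a : ι → Λ)
    (b : Fin m → ι → Λ) (y : ι) : Λ :=
  Function.update b i a (χ y) y

theorem mixLabel_of_eq {ι Λ : Type*} {m : ℕ} {χ : ι → Fin m} {i : Fin m} (a : ι → Λ)
    (b : Fin m → ι → Λ) {y : ι} (h : χ y = i) : mixLabel χ i a b y = a y := by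
  subst h
  simp [mixLabel]

/-- The random choices of one trial: a colouring, a colour, the labels of that colour class,
and `L` samples of the labels of the other classes. -/
abbrev TrialCoins (ι Λ : Type*) (m L : ℕ) :=
  ((ι → Fin m) × Fin m) × (ι → Λ) × (Fin L → Fin m → ι → Λ)

theorem one_sub_inv_pow_le_half {y : ℝ} (hy : 1 ≤ y) {L : ℕ} (hL : y ≤ L) :
    (1 - 1 / y) ^ L ≤ 1 / 2 := by
  have hy0 : 0 < y := by linarith
  have h1 : 1 - 1 / y ≤ Real.exp (-(1 / y)) := Real.one_sub_le_exp_neg _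
  have h0 : 0 ≤ 1 - 1 / y := by
    have : 1 / y ≤ 1 := by rw [div_le_one hy0]; exact hy
    linarith
  calc (1 - 1 / y) ^ L ≤ Real.exp (-(1 / y)) ^ L := pow_le_pow_left₀ h0 h1 L
    _ = Real.exp (-(L / y)) := by rw [← Real.exp_nat_mul]; congr 1; ring
    _ ≤ Real.exp (-1) := by
      rw [Real.exp_le_exp]
      have : 1 ≤ L / y := by rwa [le_div_iff₀ hy0, one_mul]
      linarith
    _ ≤ 1 / 2 := by
      rw [Real.exp_neg, one_div]
      apply inv_anti₀ (by norm_num)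
      have := Real.add_one_le_exp (1 : ℝ)
      linarith

/-- An element `x` that has probability at least `1 / Q` of being recognised from random labels is
found by one trial with probability at least `1 / (32 r)`. -/
theorem uniformPr_trial_ge {ι Λ : Type*} [Finite ι] [Finite Λ] [Nonempty Λ] {r L : ℕ}
    (hr : 0 < r) {x : ι} {H : (ι → Λ) → Prop}
    (hH : ∀ f g : ι → Λ, (∀ y, y ≠ x → f y = g y) → H f → H g) {Q : ℝ} (hQ : 1 ≤ Q)
    (hQr : 2 * Q ≤ 2 ^ r) (hL : 4 * r * Q ≤ L) (hHQ : 1 / Q ≤ uniformPr (ι → Λ) H)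
    {B : Λ → Prop} (hB : 1 / 2 ≤ uniformPr Λ B) :
    1 / (32 * r) ≤ uniformPr (TrialCoins ι Λ (2 * r) L) fun z =>
      z.1.1 x = z.1.2 ∧ B (z.2.1 x) ∧ ∃ j, H (mixLabel z.1.1 z.1.2 z.2.1 (z.2.2 j)) := by
  classical
  cases nonempty_fintype ι
  have hr' : (1 : ℝ) ≤ r := by exact_mod_cast hr
  have : Nonempty (Fin (2 * r)) := ⟨⟨0, by omega⟩⟩
  set E₂ : (ι → Fin (2 * r)) → Fin (2 * r) → (ι → Λ) → Prop := fun χ i a =>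
    1 / (4 * r * Q) ≤ uniformPr (Fin (2 * r) → ι → Λ) fun b => H (mixLabel χ i a b) with hE₂
  set E₁ : (ι → Fin (2 * r)) → Fin (2 * r) → Prop := fun χ i =>
    1 / 2 ≤ uniformPr (ι → Λ) (E₂ χ i) with hE₁
  -- As `H` ignores the label of `x`, goodness of a colour or labelling depends neither on the
  -- colour nor on the label of `x`. It is therefore independent of `χ x = i` and of `B (a x)`.
  have hE₂x : ∀ χ χ' i, (∀ y, y ≠ x → χ y = χ' y) → ∀ a, E₂ χ i a → E₂ χ' i a := by
    intro χ χ' i h a ha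
    refine ha.trans (uniformPr_mono fun b hb => hH _ _ (fun y hy => ?_) hb)
    rw [mixLabel, mixLabel, h y hy]
  have hE₂a : ∀ χ i (a a' : ι → Λ), (∀ y, y ≠ x → a y = a' y) → E₂ χ i a → E₂ χ i a' := by
    intro χ i a a' h ha
    refine ha.trans (uniformPr_mono fun b hb => hH _ _ (fun y hy => ?_) hb)
    by_cases hy' : χ y = i
    · rw [mixLabel_of_eq _ _ hy', mixLabel_of_eq _ _ hy', h y hy]
    · simp [mixLabel, hy']
  have h1 : ∀ χ, 1 / 2 ≤ uniformPr (Fin (2 * r)) (E₁ χ) := by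
    intro χ
    refine half_coordinates_good (Ω := ι → Λ) hr (fun ω => H fun y => ω (χ y) y)
      (by linarith) hQr ?_
    refine hHQ.trans_eq ?_
    -- Each colour carries its own labelling of all of `ι`. Reading at `y` the one of colour `χ y`
    -- picks distinct entries of this table, hence gives a uniform labelling.
    have hinj : Function.Injective fun y : ι => (χ y, y) := fun y z h => (Prod.ext_iff.1 h).2
    rw [← uniformPr_comp_injective hinj H,
      ← uniformPr_equiv (Equiv.curry (Fin (2 * r)) ι Λ).symm]
    rfl
  have h2 : 1 / (4 * r) ≤ uniformPr ((ι → Fin (2 * r)) × Fin (2 * r))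
      (fun z => z.1 x = z.2 ∧ E₁ z.1 z.2) := by
    have e1 : 1 / 2 ≤ uniformPr ((ι → Fin (2 * r)) × Fin (2 * r)) (fun z => E₁ z.1 z.2) := by
      have := mul_le_uniformPr_prod (α := ι → Fin (2 * r)) (A := fun _ => True) (P := E₁)
        (p := 1) (q := 1 / 2) (by norm_num) (uniformPr_of_forall fun _ => trivial).ge
        fun χ _ => h1 χ
      rwa [one_mul] at this
    rw [uniformPr_prod_comm, uniformPr_prod fun i χ => E₁ χ i] at e1
    rw [uniformPr_prod_comm (fun χ i => χ x = i ∧ E₁ χ i),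
      uniformPr_prod fun i χ => χ x = i ∧ E₁ χ i]
    have e2 : ∀ i, uniformPr (ι → Fin (2 * r)) (fun χ => χ x = i ∧ E₁ χ i) =
        uniformPr (ι → Fin (2 * r)) (fun χ => E₁ χ i) * (1 / (2 * r)) := by
      intro i
      have e3 : uniformPr (Fin (2 * r)) (fun c => c = i) = 1 / (2 * r) := by
        rw [uniformPr, Nat.card_unique, Nat.card_eq_fintype_card, Fintype.card_fin]
        push_cast
        rfl
      rw [← e3, ← uniformPr_and_coord x
        (fun χ χ' h hχ => hχ.trans (uniformPr_mono (hE₂x χ χ' i h))) (fun c => c = i)]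
      exact uniformPr_congr fun χ => and_comm
    simp_rw [e2]
    rw [← Finset.sum_mul, mul_div_right_comm]
    calc (1 : ℝ) / (4 * r) = 1 / 2 * (1 / (2 * r)) := by field_simp; norm_num
      _ ≤ _ := by gcongr
  have h3 : ∀ χ i, E₁ χ i → 1 / 4 ≤ uniformPr (ι → Λ) (fun a => B (a x) ∧ E₂ χ i a) := by
    intro χ i h
    rw [uniformPr_congr fun a => and_comm, uniformPr_and_coord x (hE₂a χ i)]
    calc (1 : ℝ) / 4 = 1 / 2 * (1 / 2) := by norm_num
      _ ≤ _ := mul_le_mul h hB (by norm_num) (uniformPr_nonneg _)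
  have h4 : ∀ χ i a, E₂ χ i a → 1 / 2 ≤ uniformPr (Fin L → Fin (2 * r) → ι → Λ)
      (fun b => ∃ j, H (mixLabel χ i a (b j))) := by
    intro χ i a h
    have e1 := uniformPr_compl (Ω := Fin L → Fin (2 * r) → ι → Λ)
      (fun b => ∃ j, H (mixLabel χ i a (b j)))
    have e2 : uniformPr (Fin L → Fin (2 * r) → ι → Λ)
        (fun b => ¬ ∃ j, H (mixLabel χ i a (b j))) =
        (1 - uniformPr (Fin (2 * r) → ι → Λ) (fun b => H (mixLabel χ i a b))) ^ L := by
      rw [uniformPr_congr fun b => not_exists,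
        uniformPr_pi (κ := Fin L) (fun _ b => ¬ H (mixLabel χ i a b)), Finset.prod_const,
        uniformPr_compl, Finset.card_univ, Fintype.card_fin]
    have e3 : (1 - uniformPr (Fin (2 * r) → ι → Λ) (fun b => H (mixLabel χ i a b))) ^ L ≤
        (1 - 1 / (4 * r * Q)) ^ L := by
      refine pow_le_pow_left₀ ?_ (by linarith) L
      linarith [uniformPr_le_one (fun b : Fin (2 * r) → ι → Λ => H (mixLabel χ i a b))]
    have e4 := one_sub_inv_pow_le_half (y := 4 * r * Q) (by nlinarith) hL
    linarith
  have h5 : ∀ χ i, E₁ χ i → 1 / 4 * (1 / 2) ≤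
      uniformPr ((ι → Λ) × (Fin L → Fin (2 * r) → ι → Λ))
        (fun z => B (z.1 x) ∧ ∃ j, H (mixLabel χ i z.1 (z.2 j))) := fun χ i h =>
    mul_le_uniformPr_prod (P := fun (a : ι → Λ) (b : Fin L → Fin (2 * r) → ι → Λ) =>
      B (a x) ∧ ∃ j, H (mixLabel χ i a (b j))) (by norm_num) (h3 χ i h) fun a ha => by
        refine (h4 χ i a ha.2).trans (uniformPr_mono fun b hb => ⟨ha.1, hb⟩)
  have h6 := mul_le_uniformPr_prod (α := (ι → Fin (2 * r)) × Fin (2 * r))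
    (β := (ι → Λ) × (Fin L → Fin (2 * r) → ι → Λ))
    (P := fun z w => z.1 x = z.2 ∧ B (w.1 x) ∧ ∃ j, H (mixLabel z.1 z.2 w.1 (w.2 j)))
    (q := 1 / 4 * (1 / 2)) (by norm_num) h2 fun z hz =>
      (h5 z.1 z.2 hz.2).trans (uniformPr_mono fun w hw => ⟨hz.1, hw⟩)
  -- The factors are `1 / (2r)` for the colour of `x`, and `1/2` each for a good colour, a good
  -- labelling of it, `B`, and success of the resampling.
  refine le_trans (le_of_eq ?_) h6
  field_simp
  norm_num

end Trial

/-! ### Certificates of redundancy and the output rule. -/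

section Certificates

variable {V : Type u}

open Classical in
/-- Every element `x` of `D` has a certificate: a set `T` of kept elements such that `T` and
`T ∪ {x}` are among the queried sets, and the answers are positive and negative respectively. -/
def Certified (g : Finset V → Prop) (𝒬 : Finset (Finset V)) (S D : Finset V) : Prop :=
  D ⊆ S ∧ ∀ x ∈ D, ∃ T, T ⊆ S ∧ Disjoint T D ∧ T ∈ 𝒬 ∧ insert x T ∈ 𝒬 ∧ g T ∧ ¬ g (insert x T)

theorem Certified.congr {g g' : Finset V → Prop} {𝒬 : Finset (Finset V)} {S D : Finset V}
    (h : Certified g 𝒬 S D) (hg : ∀ T ∈ 𝒬, g T ↔ g' T) : Certified g' 𝒬 S D := by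
  refine ⟨h.1, fun x hx => ?_⟩
  obtain ⟨T, h1, h2, h3, h4, h5, h6⟩ := h.2 x hx
  exact ⟨T, h1, h2, h3, h4, (hg _ h3).1 h5, fun h => h6 ((hg _ h4).2 h)⟩

/-- Each certificate avoids all of `D`, not only its own element, so it survives the simultaneous
deletion. -/
theorem Certified.isRedundantIn {M : Matroid V} {𝒬 : Finset (Finset V)} {S D : Finset V}
    (hS : (S : Set V) ⊆ M.E) (h : Certified (fun T => M.Indep (T : Set V)) 𝒬 S D) :
    IsRedundantIn M S D := by
  classical
  refine ⟨h.1, fun x hx => ?_⟩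
  obtain ⟨T, hTS, hTD, -, -, hI, hd⟩ := h.2 x hx
  have hsub : (T : Set V) ⊆ (S : Set V) \ (D : Set V) := fun y hy =>
    ⟨hTS hy, fun hyD => Finset.disjoint_left.1 hTD hy hyD⟩
  refine M.closure_subset_closure hsub ?_
  have hxT : x ∉ (T : Set V) := fun hxT => (hsub hxT).2 hx
  rw [hI.mem_closure_iff_of_notMem hxT]
  refine ⟨fun hi => hd ?_, Set.insert_subset (hS (h.1 hx)) hI.subset_ground⟩
  convert hi
  push_cast
  rfl

theorem exists_largest_certified (g : Finset V → Prop) (𝒬 : Finset (Finset V)) (S : Finset V) :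
    ∃ D, Certified g 𝒬 S D ∧ ∀ D', Certified g 𝒬 S D' → D'.card ≤ D.card := by
  classical
  obtain ⟨D, hD, hmax⟩ := Finset.exists_max_image (S.powerset.filter (Certified g 𝒬 S))
    Finset.card ⟨∅, Finset.mem_filter.2
      ⟨Finset.empty_mem_powerset _, Finset.empty_subset _, by simp⟩⟩
  exact ⟨D, (Finset.mem_filter.1 hD).2, fun D' hD' =>
    hmax D' (Finset.mem_filter.2 ⟨Finset.mem_powerset.2 hD'.1, hD'⟩)⟩

/-- The procedure that makes the given queries and outputs a largest certified set. -/
noncomputable def certifyingProcedure (Coins : Type u) [Finite Coins] [Nonempty Coins]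
    (queries : Finset V → Coins → Finset (Finset V)) : OneRoundProcedure V where
  Coins := Coins
  finite_coins := inferInstance
  nonempty_coins := inferInstance
  queries := queries
  -- Sets outside the batch count as dependent; this is harmless, since `Certified` consults only
  -- members of the batch.
  output S ω ans := (exists_largest_certified (fun T => ∃ h : T ∈ queries S ω, ans ⟨T, h⟩ = true)
    (queries S ω) S).choose

theorem certifyingProcedure_run {Coins : Type u} [Finite Coins] [Nonempty Coins]
    (queries : Finset V → Coins → Finset (Finset V)) (M : Matroid V) (S : Finset V) (ω : Coins) :
    Certified (fun T => M.Indep (T : Set V)) (queries S ω) S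
        ((certifyingProcedure Coins queries).run (indepOracle M) S ω) ∧
      ∀ D, Certified (fun T => M.Indep (T : Set V)) (queries S ω) S D →
        D.card ≤ ((certifyingProcedure Coins queries).run (indepOracle M) S ω).card := by
  have hg : ∀ T ∈ queries S ω,
      (∃ _ : T ∈ queries S ω, indepOracle M T = true) ↔ M.Indep (T : Set V) := by
    intro T hT
    simp [indepOracle, hT]
  have h := (exists_largest_certified (fun T => ∃ _ : T ∈ queries S ω, indepOracle M T = true)
    (queries S ω) S).choose_spec
  exact ⟨h.1.congr hg, fun D hD => h.2 D (hD.congr fun T hT => (hg T hT).symm)⟩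

/-- This serves bounded `n`, where all subsets are queried: for `x` in a circuit `C`, the set `C \
{x}` certifies `{x}`. -/
theorem exists_certified_of_powerset {M : Matroid V} {E S : Finset V} (hSE : S ⊆ E)
    (h : IsGloballyOptimal M S) :
    ∃ D, Certified (fun T => M.Indep (T : Set V)) E.powerset S D ∧ 1 ≤ D.card := by
  classical
  obtain ⟨C, hC, hCS⟩ := h.exists_isCircuit
  obtain ⟨x, hx⟩ := hC.nonempty
  set T : Finset V := S.filter fun y => y ∈ C ∧ y ≠ x with hT
  have hTC : (T : Set V) = C \ {x} := by
    ext y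
    simp only [hT, Finset.coe_filter, Set.mem_ofPred_eq, Set.mem_sdiff, Set.mem_singleton_iff]
    exact ⟨fun h => h.2, fun h => ⟨hCS h.1, h⟩⟩
  have hTS : T ⊆ S := Finset.filter_subset _ _
  refine ⟨{x}, ⟨Finset.singleton_subset_iff.2 (hCS hx), fun z hz => ?_⟩, by simp⟩
  obtain rfl := Finset.mem_singleton.1 hz
  refine ⟨T, hTS, by simp [hT], Finset.mem_powerset.2 (hTS.trans hSE), ?_, ?_, ?_⟩
  · rw [Finset.mem_powerset]
    convert Finset.insert_subset (hSE (hCS hx)) (hTS.trans hSE)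
  · change M.Indep (T : Set V)
    rw [hTC]
    exact hC.sdiff_singleton_indep hx
  · intro hI
    refine hC.dep.not_indep (hI.subset fun y hy => ?_)
    by_cases hyz : y = z
    · simp [hyz]
    · have : y ∈ (T : Set V) := by rw [hTC]; exact ⟨hy, hyz⟩
      simp only [Finset.coe_insert, Set.mem_insert_iff]
      exact Or.inr this

end Certificates

/-! ### Query sets and the success probability of repeated trials. -/

section TrialQueries

variable {V : Type u}

/-- The set of elements of label less than `k` in the `j`-th sample of a trial. -/
def trialSet {S : Finset V} {m L : ℕ} (z : TrialCoins S (Fin S.card) m L) (j : Fin L) (k : ℕ) :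
    Finset V :=
  belowLabel k (mixLabel z.1.1 z.1.2 z.2.1 (z.2.2 j))

open Classical in
/-- The sets queried in one trial. -/
noncomputable def trialQueries {S : Finset V} {m L : ℕ} (z : TrialCoins S (Fin S.card) m L) :
    Finset (Finset V) :=
  (Finset.univ ×ˢ Finset.range (S.card / 2)).biUnion fun p =>
    insert (trialSet z p.1 p.2) (S.image fun x => insert x (trialSet z p.1 p.2))

open Classical in
/-- The sets queried in a sequence of trials. -/
noncomputable def batchQueries {S : Finset V} {m L R : ℕ}
    (ω : Fin R → TrialCoins S (Fin S.card) m L) : Finset (Finset V) :=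
  Finset.univ.biUnion fun t => trialQueries (ω t)

theorem card_batchQueries_le {S : Finset V} {m L R : ℕ}
    (ω : Fin R → TrialCoins S (Fin S.card) m L) :
    (batchQueries ω).card ≤ R * (L * (S.card / 2) * (S.card + 1)) := by
  classical
  rw [batchQueries]
  refine (Finset.card_biUnion_le_card_mul _ _ (L * (S.card / 2) * (S.card + 1))
    fun t _ => ?_).trans (by simp)
  rw [trialQueries]
  refine (Finset.card_biUnion_le_card_mul _ _ (S.card + 1) fun p _ => ?_).trans (by simp)
  exact (Finset.card_insert_le _ _).trans (Nat.succ_le_succ Finset.card_image_le)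

theorem notMem_of_spans {M : Matroid V} {x : V} {T : Finset V} (h : Spans M x T) : x ∉ T :=
  fun hx => h.2 (by rw [Set.insert_eq_of_mem (Finset.mem_coe.2 hx)]; exact h.1)

theorem mem_belowLabel {S : Finset V} {N k : ℕ} {l : S → Fin N} {y : S} :
    (y : V) ∈ belowLabel k l ↔ (l y : ℕ) < k := by
  simp [belowLabel]

theorem belowLabel_subset {S : Finset V} {N k : ℕ} {l : S → Fin N} : belowLabel k l ⊆ S := by
  intro y hy
  obtain ⟨z, _, rfl⟩ := Finset.mem_map.1 hy
  exact z.2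

theorem half_le_uniformPr_fin {N : ℕ} (hN : 0 < N) :
    1 / 2 ≤ uniformPr (Fin N) fun c => N / 2 ≤ (c : ℕ) := by
  have : Nonempty (Fin N) := ⟨⟨0, hN⟩⟩
  have hN' : (0 : ℝ) < N := by exact_mod_cast hN
  have h1 : uniformPr (Fin N) (fun c => (c : ℕ) < N / 2) ≤ 1 / 2 := by
    rw [uniformPr, Nat.card_eq_fintype_card, Nat.card_eq_fintype_card, Fintype.card_subtype,
      Fintype.card_fin]
    have h := card_firstPositions (Nat.div_le_self N 2)
    rw [firstPositions] at h
    rw [h, div_le_div_iff₀ hN' (by norm_num), one_mul]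
    exact_mod_cast Nat.div_mul_le_self N 2
  have h2 := uniformPr_compl (Ω := Fin N) fun c => (c : ℕ) < N / 2
  rw [uniformPr_congr fun c => not_lt] at h2
  linarith

/-- One trial certifies a large set with probability at least `1 / (64 r)`. -/
theorem uniformPr_trial_certified_ge {M : Matroid V} {S : Finset V} {r L : ℕ} (hr : 0 < r)
    {Q : ℝ} (hQ : 1 ≤ Q) (hQr : 2 * Q ≤ 2 ^ r) (hL : 4 * r * Q ≤ L) (hS : S.Nonempty)
    {X : Finset S} (hX : S.card ≤ 2 * X.card)
    (hspan : ∀ x ∈ X, ∃ k < S.card / 2,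
      1 / Q ≤ uniformPr (S → Fin S.card) fun l => Spans M x (belowLabel k l)) :
    1 / (64 * r) ≤ uniformPr (TrialCoins S (Fin S.card) (2 * r) L) fun z =>
      ∃ D, Certified (fun T => M.Indep (T : Set V)) (trialQueries z) S D ∧
        (S.card : ℝ) / (128 * r) ≤ D.card := by
  classical
  have hS0 : 0 < S.card := hS.card_pos
  have hr0 : (0 : ℝ) < r := by exact_mod_cast hr
  have : Nonempty (Fin S.card) := ⟨⟨0, hS0⟩⟩
  have : Nonempty (Fin (2 * r)) := ⟨⟨0, by omega⟩⟩
  -- Erasing `x` makes the event independent of the label of `x`. Nothing is lost, because a spanned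
  -- element lies outside the independent set that spans it.
  set H : S → (S → Fin S.card) → Prop := fun x l =>
    ∃ k < S.card / 2, Spans M x ((belowLabel k l).erase x) with hH
  have hHinv : ∀ (x : S) (f g : S → Fin S.card), (∀ y, y ≠ x → f y = g y) → H x f → H x g := by
    rintro x f g hfg ⟨k, hk, h⟩
    refine ⟨k, hk, ?_⟩
    have : (belowLabel k g).erase (x : V) = (belowLabel k f).erase (x : V) := by
      ext v
      simp only [Finset.mem_erase]
      refine and_congr_right fun hv => ?_
      by_cases hvS : v ∈ S
      · have h1 := mem_belowLabel (l := f) (k := k) (y := ⟨v, hvS⟩)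
        have h2 := mem_belowLabel (l := g) (k := k) (y := ⟨v, hvS⟩)
        rw [hfg _ fun h => hv (congrArg Subtype.val h)] at h1
        exact h2.trans h1.symm
      · exact ⟨fun h => absurd (belowLabel_subset h) hvS,
          fun h => absurd (belowLabel_subset h) hvS⟩
    rwa [this]
  set D : TrialCoins S (Fin S.card) (2 * r) L → Finset S := fun z => Finset.univ.filter fun x =>
    z.1.1 x = z.1.2 ∧ S.card / 2 ≤ (z.2.1 x : ℕ) ∧
      ∃ j, H x (mixLabel z.1.1 z.1.2 z.2.1 (z.2.2 j)) with hD
  have hXne : X.Nonempty := Finset.card_pos.1 (by omega)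
  have hp : ∀ x ∈ X, 1 / (32 * r : ℝ) ≤
      uniformPr (TrialCoins S (Fin S.card) (2 * r) L) fun z => x ∈ D z := by
    intro x hx
    obtain ⟨k, hk, h⟩ := hspan x hx
    refine (uniformPr_trial_ge hr (hHinv x) hQ hQr hL (h.trans (uniformPr_mono fun l hl => ?_))
      (half_le_uniformPr_fin hS0)).trans_eq (uniformPr_congr fun z => ?_)
    · refine ⟨k, hk, ?_⟩
      rwa [Finset.erase_eq_of_notMem (notMem_of_spans hl)]
    · simp [hD]
  have hcard := uniformPr_card_ge hXne hp
  refine le_trans (le_of_eq ?_) (hcard.trans (uniformPr_mono fun z hz => ?_))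
  · field_simp
    norm_num
  refine ⟨(D z).map (Function.Embedding.subtype _), ⟨?_, fun v hv => ?_⟩, ?_⟩
  · intro v hv
    obtain ⟨x, _, rfl⟩ := Finset.mem_map.1 hv
    exact x.2
  · obtain ⟨x, hx, rfl⟩ := Finset.mem_map.1 hv
    obtain ⟨hχ, ha, j, k, hk, hsp⟩ := (Finset.mem_filter.1 hx).2
    -- Elements of `D z` have the fixed colour, so every sample gives them the same label, which is
    -- at least `S.card / 2 > k`.
    have hnot : ∀ y ∈ D z, (y : V) ∉ trialSet z j k := by
      intro y hy hyT
      obtain ⟨hχ, ha, -⟩ := (Finset.mem_filter.1 hy).2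
      rw [trialSet, mem_belowLabel, mixLabel_of_eq _ _ hχ] at hyT
      omega
    change Spans M x ((trialSet z j k).erase x) at hsp
    rw [Finset.erase_eq_of_notMem (hnot x hx)] at hsp
    have hmem : ∀ T, T ∈ insert (trialSet z j k) (S.image fun x => insert x (trialSet z j k)) →
        T ∈ trialQueries z := fun T hT =>
      Finset.mem_biUnion.2 ⟨(j, k), by simpa using hk, hT⟩
    refine ⟨trialSet z j k, belowLabel_subset, ?_, hmem _ (Finset.mem_insert_self _ _),
      ?_, hsp.1, ?_⟩
    · rw [Finset.disjoint_left]
      intro v hvT hvD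
      obtain ⟨y, hy, rfl⟩ := Finset.mem_map.1 hvD
      exact hnot y hy hvT
    · exact hmem _ (Finset.mem_insert_of_mem (Finset.mem_image.2 ⟨x, x.2, rfl⟩))
    · change ¬ M.Indep (insert (x : V) (trialSet z j k) : Finset V)
      rw [Finset.coe_insert]
      exact hsp.2
  · rw [Finset.card_map]
    refine le_trans ?_ hz
    have hX' : (S.card : ℝ) ≤ 2 * X.card := by exact_mod_cast hX
    rw [div_le_iff₀ (by positivity)]
    calc (S.card : ℝ) ≤ 2 * X.card := hX'
      _ = _ := by field_simp; norm_num

/-- `64 r n` trials certify a large set with probability at least `1 - 2 ^ (-n)`. -/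
theorem uniformPr_batch_certified_ge {M : Matroid V} {S : Finset V} {r L n : ℕ} (hr : 0 < r)
    {Q : ℝ} (hQ : 1 ≤ Q) (hQr : 2 * Q ≤ 2 ^ r) (hL : 4 * r * Q ≤ L) (hS : S.Nonempty)
    {X : Finset S} (hX : S.card ≤ 2 * X.card)
    (hspan : ∀ x ∈ X, ∃ k < S.card / 2,
      1 / Q ≤ uniformPr (S → Fin S.card) fun l => Spans M x (belowLabel k l)) :
    1 - (2 : ℝ) ^ (-(n : ℝ)) ≤
      uniformPr (Fin (64 * r * n) → TrialCoins S (Fin S.card) (2 * r) L) fun ω =>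
        ∃ D, Certified (fun T => M.Indep (T : Set V)) (batchQueries ω) S D ∧
          (S.card : ℝ) / (128 * r) ≤ D.card := by
  classical
  have hr0 : (0 : ℝ) < r := by exact_mod_cast hr
  have : Nonempty (Fin S.card) := ⟨⟨0, hS.card_pos⟩⟩
  have : Nonempty (Fin (2 * r)) := ⟨⟨0, by omega⟩⟩
  set G : TrialCoins S (Fin S.card) (2 * r) L → Prop := fun z =>
      ∃ D, Certified (fun T => M.Indep (T : Set V)) (trialQueries z) S D ∧
        (S.card : ℝ) / (128 * r) ≤ D.card with hG
  have hp : 1 / (64 * r : ℝ) ≤ uniformPr _ G :=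
    uniformPr_trial_certified_ge hr hQ hQr hL hS hX hspan
  have hfail : uniformPr (Fin (64 * r * n) → TrialCoins S (Fin S.card) (2 * r) L)
      (fun ω => ¬ ∃ t, G (ω t)) ≤ (2 : ℝ) ^ (-(n : ℝ)) := by
    rw [uniformPr_congr fun ω => not_exists,
      uniformPr_pi (fun (_ : Fin (64 * r * n)) z => ¬ G z), Finset.prod_const,
      uniformPr_compl, Finset.card_univ, Fintype.card_fin]
    calc (1 - uniformPr _ G) ^ (64 * r * n) ≤ (Real.exp (-(1 / (64 * r)))) ^ (64 * r * n) := by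
          refine pow_le_pow_left₀ (by linarith [uniformPr_le_one G]) ?_ _
          have := Real.one_sub_le_exp_neg (1 / (64 * r : ℝ))
          linarith
      _ = Real.exp (-n) := by
          rw [← Real.exp_nat_mul]
          congr 1
          push_cast
          field_simp
      _ ≤ Real.exp (Real.log 2 * -n) := by
          rw [Real.exp_le_exp]
          have h1 : Real.log 2 ≤ 1 := by
            have := Real.log_two_lt_d9
            linarith
          have h2 : (0 : ℝ) ≤ n := Nat.cast_nonneg n
          nlinarith
      _ = _ := (Real.rpow_def_of_pos (by norm_num) _).symm
  rw [uniformPr_compl] at hfail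
  have hmono : uniformPr (Fin (64 * r * n) → TrialCoins S (Fin S.card) (2 * r) L)
      (fun ω => ∃ t, G (ω t)) ≤ _ := uniformPr_mono fun ω hω => by
    obtain ⟨t, D, hD, hcard⟩ := hω
    refine (show ∃ D, Certified (fun T => M.Indep (T : Set V)) (batchQueries ω) S D ∧
      (S.card : ℝ) / (128 * r) ≤ D.card from ⟨D, ⟨hD.1, fun x hx => ?_⟩, hcard⟩)
    obtain ⟨T, h1, h2, h3, h4, h5⟩ := hD.2 x hx
    exact ⟨T, h1, h2, Finset.mem_biUnion.2 ⟨t, Finset.mem_univ _, h3⟩,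
      Finset.mem_biUnion.2 ⟨t, Finset.mem_univ _, h4⟩, h5⟩
  linarith

end TrialQueries

/-! ### Choice of parameters and the theorem. -/

section Main

/-- Half the number of colours used by the procedure on `n` elements. -/
def halfColours (n : ℕ) : ℕ := 8 * (Nat.log 2 n + 1)

/-- The random choices of the procedure on input `S`, in a ground set of `n` elements. -/
abbrev InputCoins {V : Type u} (n : ℕ) (S : Finset V) : Type u :=
  Fin (64 * halfColours n * n) →
    TrialCoins S (Fin S.card) (2 * halfColours n) (4 * halfColours n * n ^ 7)

instance {V : Type u} (n : ℕ) (S : Finset V) : Nonempty (InputCoins n S) := by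
  have h : ∀ x : S, 0 < S.card := fun x => Finset.card_pos.2 ⟨x, x.2⟩
  have : Nonempty (S → Fin S.card) := ⟨fun x => ⟨0, h x⟩⟩
  have : Nonempty (Fin (2 * halfColours n)) := ⟨⟨0, by rw [halfColours]; omega⟩⟩
  infer_instance

theorem card_batchQueries_le_pow {V : Type u} {n : ℕ} (hn : 2 ^ 64 ≤ n) {S : Finset V}
    (hS : S.card ≤ n) (ω : InputCoins n S) : (batchQueries ω).card ≤ n ^ 13 := by
  have hn0 : n ≠ 0 := by rintro rfl; norm_num at hn
  have hn2 : 2 ≤ n := le_trans (by norm_num) hn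
  have hl : 64 ≤ Nat.log 2 n := (Nat.le_log_iff_pow_le (by norm_num) hn0).2 hn
  have h1 : 2 ^ 23 * (Nat.log 2 n + 1) ≤ n :=
    (two_pow_mul_succ_le hl).trans ((Nat.pow_le_pow_right (by norm_num)
      (Nat.div_le_self _ _)).trans (Nat.pow_log_le_self 2 hn0))
  have h2 : 64 * halfColours n ≤ n := by
    refine le_trans ?_ h1
    rw [halfColours]
    omega
  refine (card_batchQueries_le ω).trans ?_
  -- The exponent splits as `2` for the trials, `8` for the samples, `1` for the thresholds `k` and
  -- `2` for each set with its one-element extensions.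
  calc 64 * halfColours n * n * (4 * halfColours n * n ^ 7 * (S.card / 2) * (S.card + 1))
      ≤ n * n * (n * n ^ 7 * n * (n * n)) := by
        refine Nat.mul_le_mul (Nat.mul_le_mul_right _ h2) (Nat.mul_le_mul (Nat.mul_le_mul
          (Nat.mul_le_mul_right _ (by omega)) ((Nat.div_le_self _ _).trans hS)) ?_)
        nlinarith
    _ = n ^ 13 := by ring

theorem IsGloballyOptimal.uniformPr_certified_ge {V : Type u} {M : Matroid V} {S : Finset V}
    (h : IsGloballyOptimal M S) {n : ℕ} (hn : M.E.ncard = n) (hn' : 2 ^ 64 ≤ n)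
    (hSn : S.card ≤ n)
    (hα : (circuitMedian M S : ℝ) / (S.card : ℝ) < 1 / Real.logb 2 (n : ℝ)) :
    1 - (2 : ℝ) ^ (-(n : ℝ)) ≤ uniformPr (InputCoins n S) fun ω =>
      ∃ D, Certified (fun T => M.Indep (T : Set V)) (batchQueries ω) S D ∧
        1 / 2 ^ 11 * (S.card : ℝ) / Real.logb 2 (n : ℝ) ≤ D.card := by
  obtain ⟨X, hX, hspan⟩ := h.card_spanned hn hn' hSn hα
  have hS : S.Nonempty := by
    obtain ⟨C, hC, hCS⟩ := h.exists_isCircuit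
    obtain ⟨x, hx⟩ := hC.nonempty
    exact ⟨x, hCS hx⟩
  have hn0 : n ≠ 0 := by rintro rfl; norm_num at hn'
  have hnR : (1 : ℝ) ≤ n := by exact_mod_cast Nat.one_le_iff_ne_zero.2 hn0
  have hr : 0 < halfColours n := by rw [halfColours]; omega
  -- The factor `8` in `halfColours` is the exponent `7` plus one more power of `n` to absorb the
  -- `2`.
  have hQr : 2 * (n : ℝ) ^ 7 ≤ 2 ^ halfColours n := by
    have h1 : n ≤ 2 ^ (Nat.log 2 n + 1) := (Nat.lt_pow_succ_log_self (by norm_num) n).le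
    have h2 : 2 ≤ n := le_trans (by norm_num) hn'
    have h3 : 2 * n ^ 7 ≤ 2 ^ halfColours n := by
      calc 2 * n ^ 7 ≤ n * n ^ 7 := Nat.mul_le_mul_right _ h2
        _ = n ^ 8 := by ring
        _ ≤ (2 ^ (Nat.log 2 n + 1)) ^ 8 := Nat.pow_le_pow_left h1 8
        _ = _ := by rw [← pow_mul, halfColours, mul_comm]
    exact_mod_cast h3
  refine (uniformPr_batch_certified_ge (n := n) hr (one_le_pow₀ hnR) hQr
    (le_of_eq (by push_cast; ring)) hS hX hspan).trans (uniformPr_mono ?_)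
  rintro ω ⟨D, hD, hcard⟩
  refine ⟨D, hD, le_trans ?_ hcard⟩
  have hl : 64 ≤ Nat.log 2 n := (Nat.le_log_iff_pow_le (by norm_num) hn0).2 hn'
  have hlog : (Nat.log 2 n : ℝ) ≤ Real.logb 2 n := by exact_mod_cast Real.natLog_le_logb n 2
  have hlR : (64 : ℝ) ≤ Nat.log 2 n := by exact_mod_cast hl
  have hlog0 : 0 < Real.logb 2 (n : ℝ) := by linarith
  rw [halfColours, div_le_div_iff₀ hlog0 (by positivity)]
  push_cast
  have hSR : (0 : ℝ) ≤ S.card := Nat.cast_nonneg _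
  nlinarith [mul_le_mul_of_nonneg_left (show (Nat.log 2 n : ℝ) + 1 ≤ 2 * Real.logb 2 n by linarith)
    hSR]

theorem two_pow_le_pow {n d : ℕ} (hn : 2 ≤ n) (hd : n ≤ d) : 2 ^ n ≤ n ^ d :=
  (Nat.pow_le_pow_left hn n).trans (Nat.pow_le_pow_right (by omega) hd)

theorem theorem4p1 :
    ∃ (c₁ c₂ : ℝ) (k d : ℕ), 0 < c₁ ∧ 0 < c₂ ∧
      ∀ (V : Type u) (E : Finset V), 2 ≤ E.card →
        ∃ A : OneRoundProcedure V,
          (∀ (S : Finset V) (ω : A.Coins), (A.queries S ω).card ≤ E.card ^ d) ∧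
          ∀ M : Matroid V, M.E = (E : Set V) →
            ∀ S : Finset V, IsGloballyOptimal M S →
              (circuitMedian M S : ℝ) / (S.card : ℝ) < 1 / Real.logb 2 (E.card : ℝ) →
              1 - (2 : ℝ) ^ (-(c₂ * (E.card : ℝ))) ≤
                uniformPr A.Coins fun ω =>
                  IsRedundantIn M S (A.run (indepOracle M) S ω) ∧
                  c₁ * min (S.card : ℝ)
                      ((S.card : ℝ) ^ (3 / 2 : ℝ) / (circuitMedian M S : ℝ)) /
                      Real.logb 2 (E.card : ℝ) ^ k ≤
                    ((A.run (indepOracle M) S ω).card : ℝ) := by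
  classical
  -- For `n < 2 ^ 64` this `d` pays for all `2 ^ n` subsets, and `c₁ = 1 / d` makes a single deleted
  -- element enough. It is kept abstract, so only the inequality is used.
  obtain ⟨d, hd⟩ : ∃ d : ℕ, 2 ^ 64 ≤ d := ⟨2 ^ 64, le_rfl⟩
  have hdR : (2 : ℝ) ^ 64 ≤ d := by exact_mod_cast hd
  have hd0 : (0 : ℝ) < d := lt_of_lt_of_le (by positivity) hdR
  refine ⟨1 / d, 1, 1, d, by positivity, one_pos, fun V E hE => ?_⟩
  set n := E.card with hn
  have hlog1 : 1 ≤ Real.logb 2 (n : ℝ) := by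
    rw [Real.le_logb_iff_rpow_le (by norm_num) (by positivity), Real.rpow_one]
    exact_mod_cast hE
  rcases lt_or_ge n (2 ^ 64) with hsmall | hlarge
  · refine ⟨certifyingProcedure PUnit fun _ _ => E.powerset, fun S ω => ?_,
      fun M hM S hS _ => ?_⟩
    · refine (Finset.card_powerset E).trans_le (two_pow_le_pow hE (hsmall.le.trans hd))
    · have hSE : S ⊆ E := by
        have := hS.subset_ground
        rwa [hM, Finset.coe_subset] at this
      have : Nonempty (certifyingProcedure (V := V) PUnit fun _ _ => E.powerset).Coins :=
        ⟨PUnit.unit⟩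
      have : Finite (certifyingProcedure (V := V) PUnit fun _ _ => E.powerset).Coins :=
        OneRoundProcedure.finite_coins _
      rw [uniformPr_of_forall]
      · linarith [Real.rpow_pos_of_pos (show (0 : ℝ) < 2 by norm_num) (-(1 * (n : ℝ)))]
      · intro ω
        have hrun := certifyingProcedure_run (fun _ _ => E.powerset) M S ω
        refine ⟨hrun.1.isRedundantIn hS.subset_ground, ?_⟩
        obtain ⟨D, hD, hD1⟩ := exists_certified_of_powerset hSE hS
        have h1 : (1 : ℝ) ≤ ((certifyingProcedure PUnit fun _ _ => E.powerset).run
          (indepOracle M) S ω).card := by exact_mod_cast hD1.trans (hrun.2 D hD)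
        refine le_trans ?_ h1
        have hSd : (S.card : ℝ) ≤ d := by
          exact_mod_cast (Finset.card_le_card hSE).trans (hsmall.le.trans hd)
        rw [pow_one]
        refine div_le_one_of_le₀ (le_trans ?_ hlog1) (by linarith)
        calc 1 / (d : ℝ) * min (S.card : ℝ) _ ≤ 1 / d * d := by
              gcongr
              exact (min_le_left _ _).trans hSd
          _ = 1 := by field_simp
  -- The random string may not depend on the input, so it holds independent coins for every `S ⊆ E`,
  -- of which only the coordinate at the actual input is read.
  · let queries : Finset V → (∀ S : {S // S ∈ E.powerset}, InputCoins n S.1) →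
        Finset (Finset V) := fun S ω => if h : S ∈ E.powerset then batchQueries (ω ⟨S, h⟩) else ∅
    refine ⟨certifyingProcedure (∀ S : {S // S ∈ E.powerset}, InputCoins n S.1) queries,
      fun S ω => ?_, fun M hM S hS hα => ?_⟩
    · change (queries S ω).card ≤ n ^ d
      simp only [queries]
      split_ifs with h
      · refine (card_batchQueries_le_pow hlarge
          (Finset.card_le_card (Finset.mem_powerset.1 h)) _).trans ?_
        exact Nat.pow_le_pow_right (by omega) (le_trans (by norm_num) hd)
      · simp
    · have hSE : S ⊆ E := by
        have := hS.subset_ground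
        rwa [hM, Finset.coe_subset] at this
      have hSE' : S ∈ E.powerset := Finset.mem_powerset.2 hSE
      have hnE : M.E.ncard = n := by rw [hM, Set.ncard_coe_finset]
      have key := hS.uniformPr_certified_ge hnE hlarge (Finset.card_le_card hSE) hα
      rw [← uniformPr_eval (Ω := fun S : {S // S ∈ E.powerset} => InputCoins n S.1) ⟨S, hSE'⟩]
        at key
      rw [one_mul]
      refine key.trans (uniformPr_mono fun ω => ?_)
      rintro ⟨D, hD, hcard⟩
      have hrun := certifyingProcedure_run queries M S ω
      have hq : queries S ω = batchQueries (ω ⟨S, hSE'⟩) := dif_pos hSE'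
      refine ⟨hrun.1.isRedundantIn hS.subset_ground, ?_⟩
      have h1 : (D.card : ℝ) ≤ ((certifyingProcedure _ queries).run (indepOracle M) S ω).card := by
        exact_mod_cast hrun.2 D (by rw [hq]; exact hD)
      refine le_trans (le_trans ?_ hcard) h1
      rw [pow_one]
      gcongr
      · exact le_trans (by norm_num) hdR
      · exact min_le_left _ _

end Main
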